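/- Let $\mathcal M$ be a smooth Riemannian manifold of dimension $n\ge 1$, with metric $\langle\cdot,\cdot\rangle$ and curvature tensor $R(X,Y)Z=\nabla_X\nabla_YZ-\nabla_Y\nabla_XZ-\nabla_{[X,Y]}Z$ of its Levi-Civita connection. Let $O\mathcal M$ be its orthonormal frame bundle, with points $(x,\mathbf e)$, $\mathbf e=(e^0,\dots,e^{n-1})$ an orthonormal basis of $T_x\mathcal M$, and let $\pi:O\mathcal M\to T^1\mathcal M$, $\pi(x,\mathbf e)=(x,e^0)$, be the projection onto the unit tangent bundle. In local coordinates, with $e^i=\sum_k e^i_k\partial_{x_k}$ and $\Gamma^l_{pq}$ the Christoffel symbols, consider on $O\mathcal M$ the vector fields $$V_i=\sum_k \left(e^i_k\,\partial_{e^0_k}-e^0_k\,\partial_{e^i_k}\right)\ (1\le i\le n-1),\qquad H_i=\sum_k e^i_k\,\partial_{x_k}-\sum_{k,l,p,q}\Gamma^l_{pq}\,e^k_p\,e^i_q\,\partial_{e^k_l}\ (0\le i\le n-1).$$ Let $\sigma,\kappa\in\mathbb R$. The generator $\mathcal L$ of the velocity spherical Brownian motion and the geodesic vector field $\xi$ are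 the operators on $T^1\mathcal M$ with $$(\mathcal Lf)\circ\pi=\Big(\frac{\sigma^2}{2}\sum_{i=1}^{n-1}V_i^2+\kappa H_0\Big)(f\circ\pi),\qquad (\xi f)\circ\pi=H_0(f\circ\pi).$$ For smooth $f,g:T^1\mathcal M\to\mathbb R$ the following expressions, evaluated at $(x,\mathbf e)$, depend only on $\pi(x,\mathbf e)$ and define functions on $T^1\mathcal M$: $$\Gamma^v(f,g)=\sum_{i=1}^{n-1}V_i(f\circ\pi)V_i(g\circ\pi),\qquad \Gamma^{v,\tilde h}(f,g)=\frac12\sum_{i=1}^{n-1}\big(H_i(f\circ\pi)V_i(g\circ\pi)+H_i(g\circ\pi)V_i(f\circ\pi)\big),$$ $$\Gamma^{\tilde h}(f,g)=\sum_{i=1}^{n-1}H_i(f\circ\pi)H_i(g\circ\pi),\qquad \Gamma^\xi(f,g)=H_0(f\circ\pi)H_0(g\circ\pi).$$ For each of these $\Gamma$ let $\Gamma_2(f,g)=\frac12\big(\mathcal L\,\Gamma(f,g)-\Gamma(\mathcal Lf,g)-\Gamma(f,\mathcal Lg)\big)$ and $\Gamma_2(f)=\Gamma_2(f,f)$. At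 a frame $(x,\mathbf e)$ put $$\nabla^vf=\sum_{i=1}^{n-1}V_i(f\circ\pi)e^i,\quad \nabla^{\tilde h}f=\sum_{i=1}^{n-1}H_i(f\circ\pi)e^i,\quad \nabla^\xi f=H_0(f\circ\pi)e^0,$$ and, for $1\le i,j\le n-1$, $$\mathrm{Hess}^v_{i,j}f=V_iV_j(f\circ\pi),\quad \mathrm{Hess}^{v,\tilde h}_{i,j}f=V_iH_j(f\circ\pi),\quad \mathrm{Hess}^{v,\xi}_if=V_iH_0(f\circ\pi),$$ where matrices carry the Hilbert-Schmidt scalar product and norm and $\mathrm{Hess}^{v,\xi}f$ is identified with $\sum_{i=1}^{n-1}\mathrm{Hess}^{v,\xi}_if\,e^i\in T_x\mathcal M$. Lemma 1. For every smooth $f:T^1\mathcal M\to\mathbb R$ and every frame $(x,\mathbf e)\in O\mathcal M$, one has at $(x,e^0)$ $$\begin{aligned}\Gamma_2^v(f)&=\frac{\sigma^2}{2}\left(\|\mathrm{Hess}^vf\|^2+(n-2)\|\nabla^vf\|^2\right)-\kappa\langle\nabla^vf,\nabla^{\tilde h}f\rangle,\\ \Gamma_2^{v,\tilde h}(f)&=\frac{\sigma^2}{2}\left(\langle\mathrm{Hess}^vf,\mathrm{Hess}^{v,\tilde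 h}f\rangle+\frac{n-1}{2}\langle\nabla^vf,\nabla^{\tilde h}f\rangle-\langle\mathrm{Hess}^{v,\xi}f,\nabla^vf\rangle\right)\\&\quad+\frac{\kappa}{2}\left(\langle R(\nabla^vf,e^0)e^0,\nabla^vf\rangle-\|\nabla^{\tilde h}f\|^2\right),\\ \Gamma_2^{\tilde h}(f)&=\frac{\sigma^2}{2}\left(\|\mathrm{Hess}^{v,\tilde h}f\|^2+\|\nabla^{\tilde h}f\|^2-2\langle\mathrm{Hess}^{v,\xi}f,\nabla^{\tilde h}f\rangle\right)+\kappa\langle R(\nabla^vf,e^0)e^0,\nabla^{\tilde h}f\rangle,\\ \Gamma_2^\xi(f)&=\frac{\sigma^2}{2}\left(\|\mathrm{Hess}^{v,\xi}f\|^2+(n-1)\|\nabla^\xi f\|^2+2\,\mathrm{Tr}(\mathrm{Hess}^{v,\tilde h}f)\,\xi(f)\right).\end{aligned}$$ -/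

import Mathlib

open Bundle
open scoped Manifold ContDiff Topology InnerProductSpace

noncomputable section

namespace VSBM

/-- The model space `ℝⁿ` with `n = m + 1`; its canonical basis is indexed by `0, …, n - 1`. -/
abbrev Mod (m : ℕ) : Type := EuclideanSpace ℝ (Fin (m + 1))

theorem exists_basis {m : ℕ} {G : Type*} [NormedAddCommGroup G] [InnerProductSpace ℝ G]
    [FiniteDimensional ℝ G] (hG : Module.finrank ℝ G = Fintype.card (Fin (m + 1)))
    (v : G) (hv : ‖v‖ = 1) :
    ∃ b : OrthonormalBasis (Fin (m + 1)) ℝ G, b 0 = v := by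
  have ho : Orthonormal ℝ (Set.domRestrict ({0} : Set (Fin (m + 1))) (fun _ => v)) :=
    ⟨fun _ => hv, fun i j hij => (hij (Subsingleton.elim i j)).elim⟩
  obtain ⟨b, hb⟩ := ho.exists_orthonormalBasis_extension_of_card_eq hG
  exact ⟨b, hb 0 (Set.mem_singleton 0)⟩

section Riemannian

variable {m : ℕ} {M : Type*} [TopologicalSpace M] [ChartedSpace (Mod m) M]

/-! ### Objects read in a chart

The chart is the preferred chart around a point `c` of `M`. -/

/-- Coordinates, in the chart around `c`, of a tangent vector at `x`. -/
def coords (c x : M) (X : TangentSpace (𝓡 (m + 1)) x) : Mod m :=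
  mfderiv (𝓡 (m + 1)) 𝓘(ℝ, Mod m) (extChartAt (𝓡 (m + 1)) c) x X

/-- The tangent vector at `x` with given coordinates in the chart around `c`. -/
def vecOf (c x : M) (w : Mod m) : TangentSpace (𝓡 (m + 1)) x :=
  (mfderiv (𝓡 (m + 1)) 𝓘(ℝ, Mod m) (extChartAt (𝓡 (m + 1)) c) x).inverse w

/-- The point of `M` with coordinates `y` in the chart around `c`. -/
def ptOf (c : M) (y : Mod m) : M := (extChartAt (𝓡 (m + 1)) c).symm y

/-- The `i`-th vector of the canonical basis of `ℝⁿ`. -/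
def bvec (i : Fin (m + 1)) : Mod m := EuclideanSpace.single i 1

/-- Partial derivative in the `i`-th coordinate. -/
def pd (i : Fin (m + 1)) (h : Mod m → ℝ) (y : Mod m) : ℝ := fderiv ℝ h y (bvec i)

theorem finrank_tangent (x : M) :
    Module.finrank ℝ (TangentSpace (𝓡 (m + 1)) x) = Fintype.card (Fin (m + 1)) := by
  change Module.finrank ℝ (EuclideanSpace ℝ (Fin (m + 1))) = _
  simp

instance finiteDimensional_tangent (x : M) :
    FiniteDimensional ℝ (TangentSpace (𝓡 (m + 1)) x) :=
  inferInstanceAs (FiniteDimensional ℝ (EuclideanSpace ℝ (Fin (m + 1))))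

variable [RiemannianBundle (fun x : M => TangentSpace (𝓡 (m + 1)) x)]

/-- The matrix `g_{ij}(y)` of the metric in the chart around `c`. -/
def metricMat (c : M) (y : Mod m) : Matrix (Fin (m + 1)) (Fin (m + 1)) ℝ :=
  Matrix.of fun i j => ⟪vecOf c (ptOf c y) (bvec i), vecOf c (ptOf c y) (bvec j)⟫_ℝ

/-- Christoffel symbols of the Levi-Civita connection,
`Γ^l_{ij} = ½ ∑ₖ g^{lk} (∂ᵢ g_{jk} + ∂ⱼ g_{ik} - ∂ₖ g_{ij})`. -/
def christoffel (c : M) (l i j : Fin (m + 1)) (y : Mod m) : ℝ :=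
  (1 / 2) * ∑ k, (metricMat c y)⁻¹ l k *
    (pd i (fun z => metricMat c z j k) y + pd j (fun z => metricMat c z i k) y
      - pd k (fun z => metricMat c z i j) y)

/-- Components of the Riemann tensor: `R(∂ᵢ, ∂ⱼ)∂ₖ = ∑ₗ R^l_{kij} ∂ₗ`, with the convention
`R(X, Y)Z = ∇_X ∇_Y Z - ∇_Y ∇_X Z - ∇_{[X, Y]} Z`. -/
def riemannCoeff (c : M) (l k i j : Fin (m + 1)) (y : Mod m) : ℝ :=
  pd i (christoffel c l j k) y - pd j (christoffel c l i k) y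
    + ∑ p, (christoffel c l i p y * christoffel c p j k y
      - christoffel c l j p y * christoffel c p i k y)

/-- The Riemann curvature tensor `R(X, Y)Z` at the point `x`. -/
def riemann (x : M) (X Y Z : TangentSpace (𝓡 (m + 1)) x) : TangentSpace (𝓡 (m + 1)) x :=
  vecOf x x (WithLp.toLp 2 fun l => ∑ i, ∑ j, ∑ k,
    riemannCoeff x l k i j (extChartAt (𝓡 (m + 1)) x x)
      * coords x x X i * coords x x Y j * coords x x Z k)

/-! ### Unit tangent bundle and orthonormal frame bundle -/

variable (m M) in
/-- The unit tangent bundle `T¹M`. -/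
def UnitTangent : Type _ :=
  {p : TangentBundle (𝓡 (m + 1)) M // ‖(p.2 : TangentSpace (𝓡 (m + 1)) p.1)‖ = 1}

variable (m M) in
/-- The orthonormal frame bundle `OM`: a point together with an orthonormal frame
`(e⁰, …, e^{n-1})` of its tangent space. -/
structure OFrame where
  /-- The base point. -/
  pt : M
  /-- The frame. -/
  e : OrthonormalBasis (Fin (m + 1)) ℝ (TangentSpace (𝓡 (m + 1)) pt)

/-- The projection `π : OM → T¹M`, `(x, e) ↦ (x, e⁰)`. -/
def proj (u : OFrame m M) : UnitTangent m M :=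
  ⟨⟨u.pt, u.e 0⟩, u.e.orthonormal.1 0⟩

theorem exists_frame (p : UnitTangent m M) : ∃ u : OFrame m M, proj u = p := by
  obtain ⟨⟨x, v⟩, hv⟩ := p
  have h := exists_basis (m := m) (G := TangentSpace (𝓡 (m + 1)) x) (finrank_tangent x)
  obtain ⟨b, hb⟩ := h v hv
  refine ⟨⟨x, b⟩, Subtype.ext ?_⟩
  change (⟨x, b 0⟩ : TangentBundle (𝓡 (m + 1)) M) = ⟨x, v⟩
  rw [hb]

/-- A frame over a given point of `T¹M`. -/
def someFrame (p : UnitTangent m M) : OFrame m M := (exists_frame p).choose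

/-- Smooth functions on `T¹M`: those which near each point of the submanifold `T¹M` of `TM` are the
restriction of a smooth function defined on an open subset of `TM`. -/
def SmoothOnUnitTangent [IsManifold (𝓡 (m + 1)) ∞ M] (f : UnitTangent m M → ℝ) : Prop :=
  ∀ p : UnitTangent m M, ∃ U : Set (TangentBundle (𝓡 (m + 1)) M), IsOpen U ∧ p.1 ∈ U ∧
    ∃ g : TangentBundle (𝓡 (m + 1)) M → ℝ,
      ContMDiffOn (𝓡 (m + 1)).tangent 𝓘(ℝ, ℝ) ∞ g U ∧
      ∀ q : UnitTangent m M, q.1 ∈ U → f q = g q.1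

/-! ### Vector fields on `OM` -/

/-- The orthonormal frame at the point of coordinates `y` obtained by orthonormalising
(Gram-Schmidt) the vectors with coordinates `A 0, …, A (n - 1)`. It is a smooth retraction of the
bundle of linear frames onto `OM`, written in the coordinates given by the chart around `c`. -/
def frameOf (c : M) (y : Mod m) (A : Fin (m + 1) → Mod m) : OFrame m M :=
  ⟨ptOf c y, InnerProductSpace.gramSchmidtOrthonormalBasis (finrank_tangent (ptOf c y))
    fun k => vecOf c (ptOf c y) (A k)⟩

/-- The coordinates `A k` of the frame vector `e^k`, in the chart around the base point. -/
def frameCoords (u : OFrame m M) (k : Fin (m + 1)) : Mod m := coords u.pt u.pt (u.e k)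

/-- Derivative at `u` of a function `F` on `OM` along the vector tangent to `OM` whose coordinates
are `w` (base part) and `B` (frame part). As the vector is tangent to `OM` and `frameOf` is a
retraction onto `OM`, orthonormalising the line does not change its velocity at `0`. -/
def dirDeriv (F : OFrame m M → ℝ) (u : OFrame m M) (w : Mod m) (B : Fin (m + 1) → Mod m) : ℝ :=
  deriv (fun t : ℝ =>
    F (frameOf u.pt (extChartAt (𝓡 (m + 1)) u.pt u.pt + t • w) (frameCoords u + t • B))) 0

/-- The vertical fields `V_i = ∑ₖ e^i_k ∂/∂e^0_k - e^0_k ∂/∂e^i_k`, `1 ≤ i ≤ n - 1`; the index `i`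
is written `i.succ` with `i : Fin m`. -/
def V (i : Fin m) (F : OFrame m M → ℝ) (u : OFrame m M) : ℝ :=
  dirDeriv F u 0 fun k =>
    if k = 0 then frameCoords u i.succ else if k = i.succ then -frameCoords u 0 else 0

/-- The horizontal fields
`H_i = ∑ₖ e^i_k ∂/∂x_k - ∑ Γ^l_{pq} e^k_p e^i_q ∂/∂e^k_l`, `0 ≤ i ≤ n - 1`. -/
def H (i : Fin (m + 1)) (F : OFrame m M → ℝ) (u : OFrame m M) : ℝ :=
  dirDeriv F u (frameCoords u i) fun k => WithLp.toLp 2 fun l =>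
    -∑ p, ∑ q, christoffel u.pt l p q (extChartAt (𝓡 (m + 1)) u.pt u.pt)
      * frameCoords u k p * frameCoords u i q

/-! ### The generator -/

/-- `(σ² / 2) ∑ᵢ V_i² + κ H_0` on `OM`. -/
def frameGen (σ κ : ℝ) (F : OFrame m M → ℝ) (u : OFrame m M) : ℝ :=
  σ ^ 2 / 2 * ∑ i, V i (V i F) u + κ * H 0 F u

/-- The generator `L` on `T¹M`, the projection of `frameGen`: `frameGen (f ∘ π) = (L f) ∘ π`.
For smooth `f` the value does not depend on the frame over `p`. -/
def gen (σ κ : ℝ) (f : UnitTangent m M → ℝ) (p : UnitTangent m M) : ℝ :=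
  frameGen σ κ (f ∘ proj) (someFrame p)

/-- The geodesic vector field `ξ` on `T¹M`, the projection of `H_0`. -/
def xi (f : UnitTangent m M → ℝ) (p : UnitTangent m M) : ℝ := H 0 (f ∘ proj) (someFrame p)

/-! ### Gamma operators

They are functions on `T¹M`, computed in any frame over the point. -/

/-- `Γ^v`. -/
def gammaV (f g : UnitTangent m M → ℝ) (p : UnitTangent m M) : ℝ :=
  ∑ i, V i (f ∘ proj) (someFrame p) * V i (g ∘ proj) (someFrame p)

/-- `Γ^{v,h̃}`. -/
def gammaVH (f g : UnitTangent m M → ℝ) (p : UnitTangent m M) : ℝ :=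
  (1 / 2) * ∑ i : Fin m,
    (H i.succ (f ∘ proj) (someFrame p) * V i (g ∘ proj) (someFrame p)
      + H i.succ (g ∘ proj) (someFrame p) * V i (f ∘ proj) (someFrame p))

/-- `Γ^{h̃}`. -/
def gammaH (f g : UnitTangent m M → ℝ) (p : UnitTangent m M) : ℝ :=
  ∑ i : Fin m, H i.succ (f ∘ proj) (someFrame p) * H i.succ (g ∘ proj) (someFrame p)

/-- `Γ^ξ`. -/
def gammaXi (f g : UnitTangent m M → ℝ) (p : UnitTangent m M) : ℝ :=
  H 0 (f ∘ proj) (someFrame p) * H 0 (g ∘ proj) (someFrame p)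

/-- The iterated operator `Γ₂(f, g) = ½ (L Γ(f, g) - Γ(L f, g) - Γ(f, L g))` attached to `Γ`. -/
def gammaTwo (σ κ : ℝ)
    (Γ : (UnitTangent m M → ℝ) → (UnitTangent m M → ℝ) → UnitTangent m M → ℝ)
    (f g : UnitTangent m M → ℝ) (p : UnitTangent m M) : ℝ :=
  (1 / 2) * (gen σ κ (Γ f g) p - Γ (gen σ κ f) g p - Γ f (gen σ κ g) p)

/-! ### Gradients and Hessians, in a frame -/

/-- `∇^v f = ∑_{i=1}^{n-1} V_i(f ∘ π) e^i`. -/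
def gradV (f : UnitTangent m M → ℝ) (u : OFrame m M) : TangentSpace (𝓡 (m + 1)) u.pt :=
  ∑ i : Fin m, V i (f ∘ proj) u • u.e i.succ

/-- `∇^{h̃} f = ∑_{i=1}^{n-1} H_i(f ∘ π) e^i`. -/
def gradH (f : UnitTangent m M → ℝ) (u : OFrame m M) : TangentSpace (𝓡 (m + 1)) u.pt :=
  ∑ i : Fin m, H i.succ (f ∘ proj) u • u.e i.succ

/-- `∇^ξ f = H_0(f ∘ π) e^0`. -/
def gradXi (f : UnitTangent m M → ℝ) (u : OFrame m M) : TangentSpace (𝓡 (m + 1)) u.pt :=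
  H 0 (f ∘ proj) u • u.e 0

/-- `Hess^v_{ij} f = V_i V_j (f ∘ π)`. -/
def hessV (f : UnitTangent m M → ℝ) (u : OFrame m M) : Matrix (Fin m) (Fin m) ℝ :=
  Matrix.of fun i j => V i (V j (f ∘ proj)) u

/-- `Hess^{v,h̃}_{ij} f = V_i H_j (f ∘ π)`. -/
def hessVH (f : UnitTangent m M → ℝ) (u : OFrame m M) : Matrix (Fin m) (Fin m) ℝ :=
  Matrix.of fun i j => V i (H j.succ (f ∘ proj)) u

/-- The vector `∑_{i=1}^{n-1} Hess^{v,ξ}_i f e^i`, where `Hess^{v,ξ}_i f = V_i H_0 (f ∘ π)`. -/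
def hessVXi (f : UnitTangent m M → ℝ) (u : OFrame m M) : TangentSpace (𝓡 (m + 1)) u.pt :=
  ∑ i : Fin m, V i (H 0 (f ∘ proj)) u • u.e i.succ

end Riemannian

/-- The Euclidean (Hilbert-Schmidt) scalar product of matrices. -/
def hs {m : ℕ} (A B : Matrix (Fin m) (Fin m) ℝ) : ℝ := ∑ i, ∑ j, A i j * B i j

end VSBM

end

/-! All operators of the statement come from the fields `V_i`, `H_i` on the frame bundle, and the
four formulas follow from the structure equations of these fields and the Leibniz rule. Write `L = s
∑ V_j² + κ H_0` with `s = σ²/2`, and let `Γ(a, a) = ∑ x_i y_i` with `x_i`, `y_i` first derivatives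
of `a` along the fields. Then `L Γ(a, a) - Γ(La, a) - Γ(a, La)` is the sum of `2s ∑ V_j x_i V_j
y_i`, which gives the Hessian products, and of the commutators of `L` with the fields, paired with
the gradients (`algGen_sum_mul`, then the `eval_` lemmas).

The commutators (`gen_vert`, `gen_hor`, `gen_geod`) follow from `[V_i, H_0] = H_i`, `[V_i, H_j] =
-δ_ij H_0`, the vanishing of `[V_i, V_j]` on functions lifted from `T¹M`, the `so(n)` relation
`[[V_j, V_i], V_j] = V_i` for `i ≠ j`, and the curvature identity `[H_0, H_i] a = ∑_j ⟨R(e^i,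
e^0)e^0, e^j⟩ V_j a` for lifted `a`. See `frameRelations` and `commutator_hor_apply`.

The rest justifies computing in one chart. Derivatives at a frame are defined in the chart around
its own base point, after a Gram-Schmidt step, so iterated derivatives mix charts. Gram-Schmidt has
no first-order effect along directions tangent to `OM` (`OrthoCurve.gramSchmidtNormed`), and the
transformation law of Christoffel symbols (`IsLeviCivita.transform`) makes `H_i` independent of the
chart; hence `V_eq` and `H_eq`. In a fixed chart the fields extend to an open set of arbitrary
`n`-tuples of vectors, and act as derivations of an algebra of smooth functions.

Finally, `gen` and the `Γ`'s are evaluated in an arbitrarily chosen frame over each point of `T¹M`.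
Two such frames differ by an orthogonal matrix fixing the first index, which rotates the families
`V`, `H` and preserves the sums involved (`represents_of_rot`, `represents_gen`). -/

noncomputable section

namespace VSBM

/-! ### Commutation of a second order operator with a family of derivations -/

section Algebra

variable {m : ℕ} {A : Type*} [CommRing A] [Algebra ℝ A]

/-- The operator `s ∑ᵢ V_i² + κ H_0` in a commutative algebra. -/
def algGen (s κ : ℝ) (V : Fin m → Derivation ℝ A A) (H : Fin (m + 1) → Derivation ℝ A A) (b : A) :
    A :=
  s • ∑ i, V i (V i b) + κ • H 0 b

/-- The drift `H_0` obeys the Leibniz rule, so only the squares `V_j²` leave a cross term. -/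
theorem algGen_mul (s κ : ℝ) (V : Fin m → Derivation ℝ A A) (H : Fin (m + 1) → Derivation ℝ A A)
    (b c : A) :
    algGen s κ V H (b * c) = algGen s κ V H b * c + b * algGen s κ V H c
      + (2 * s) • ∑ j, V j b * V j c := by
  have h : ∀ j, V j (V j (b * c)) = V j (V j b) * c + b * V j (V j c)
      + 2 * (V j b * V j c) := by
    intro j
    simp only [Derivation.leibniz, map_add, smul_eq_mul]
    ring
  simp only [algGen, h, Finset.sum_add_distrib]
  simp only [Derivation.leibniz, smul_eq_mul, ← Finset.sum_mul, ← Finset.mul_sum,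
    Algebra.smul_def, map_mul, map_ofNat]
  ring

/-- The commutation relations of the fields `V_i`, `H_i`, applied to an element `a` whose
derivatives along the brackets `[V_i, V_j]` vanish. -/
structure FrameRelations (V : Fin m → Derivation ℝ A A) (H : Fin (m + 1) → Derivation ℝ A A)
    (a : A) (ρ : Fin m → A) : Prop where
  vert_geod : ∀ i b, V i (H 0 b) = H 0 (V i b) + H i.succ b
  vert_hor : ∀ i j b, V i (H j.succ b) = H j.succ (V i b) - if i = j then H 0 b else 0
  vert_laplacian : ∀ i, ∑ j, V j (V j (V i a)) - V i (∑ j, V j (V j a))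
    = ((m : ℝ) - 1) • V i a
  geod_hor : ∀ i, H 0 (H i.succ a) - H i.succ (H 0 a) = ρ i

namespace FrameRelations

variable {s κ : ℝ} {V : Fin m → Derivation ℝ A A} {H : Fin (m + 1) → Derivation ℝ A A}
  {a : A} {ρ : Fin m → A}

/-- The diffusion part contributes the constant of `vert_laplacian`; the drift contributes `κ [H_0,
V_i] = -κ H_i`. -/
theorem gen_vert (h : FrameRelations V H a ρ) (i : Fin m) :
    algGen s κ V H (V i a) - V i (algGen s κ V H a)
      = (s * ((m : ℝ) - 1)) • V i a - κ • H i.succ a := by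
  have h1 := h.vert_laplacian i
  rw [sub_eq_iff_eq_add] at h1
  simp only [algGen, map_add, Derivation.map_smul, h1, h.vert_geod]
  module

/-- Only `V_i²` fails to commute with `H_i`. Its defect `-(H_0 V_i + V_i H_0)` becomes `H_i - 2 V_i
H_0` by `vert_geod`; the drift leaves the curvature term `ρ`. -/
theorem gen_hor (h : FrameRelations V H a ρ) (i : Fin m) :
    algGen s κ V H (H i.succ a) - H i.succ (algGen s κ V H a)
      = s • (H i.succ a - (2 : ℝ) • V i (H 0 a)) + κ • ρ i := by
  have h1 : ∀ j, V j (V j (H i.succ a)) = H i.succ (V j (V j a))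
      - if j = i then (H 0 (V i a) + V i (H 0 a)) else 0 := by
    intro j
    rw [h.vert_hor, map_sub, h.vert_hor]
    split_ifs with hj
    · subst hj; abel
    · simp
  have h2 := h.geod_hor i
  rw [sub_eq_iff_eq_add] at h2
  have h3 := h.vert_geod i a
  rw [← sub_eq_iff_eq_add] at h3
  simp only [algGen, map_add, Derivation.map_smul, h1, h2, Finset.sum_sub_distrib,
    Finset.sum_ite_eq', Finset.mem_univ, if_true, map_sum, ← h3]
  module

/-- Each `V_j²` contributes `2 V_j H_j + H_0` when moved past `H_0`; the drift commutes with `H_0`,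
so no `κ` remains. -/
theorem gen_geod (h : FrameRelations V H a ρ) :
    algGen s κ V H (H 0 a) - H 0 (algGen s κ V H a)
      = s • ((2 : ℝ) • ∑ j, V j (H j.succ a) + (m : ℝ) • H 0 a) := by
  have h1 : ∀ j, V j (V j (H 0 a)) = H 0 (V j (V j a)) + ((2 : ℝ) • V j (H j.succ a) + H 0 a) := by
    intro j
    rw [h.vert_geod, map_add, h.vert_geod, h.vert_hor, if_pos rfl]
    module
  simp only [algGen, map_add, Derivation.map_smul, h1, Finset.sum_add_distrib, map_sum,
    ← Finset.smul_sum, Finset.sum_const, Finset.card_univ, Fintype.card_fin]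
  module

end FrameRelations

end Algebra

/-! ### Smooth functions on an open set and their derivations -/

section Calculus

variable {P : Type*} [NormedAddCommGroup P] [NormedSpace ℝ P]

/-- The functions which are smooth on `N`. -/
def smoothOn (N : Set (P)) : Subalgebra ℝ (P → ℝ) where
  carrier := {φ | ContDiffOn ℝ ∞ φ N}
  mul_mem' h1 h2 := ContDiffOn.mul h1 h2
  add_mem' h1 h2 := ContDiffOn.add h1 h2
  algebraMap_mem' _ := contDiffOn_const

variable {N : Set (P)}

theorem smoothOn.differentiableAt (hN : IsOpen N) (φ : smoothOn N) {z : P}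
    (hz : z ∈ N) : DifferentiableAt ℝ φ.1 z :=
  (ContDiffOn.contDiffAt φ.2 (hN.mem_nhds hz)).differentiableAt (by simp)

open Classical in
/-- The derivation of the functions smooth on `N` given by a smooth vector field. -/
def lieDer (hN : IsOpen N) (X : P → P) (hX : ContDiffOn ℝ ∞ X N) :
    Derivation ℝ (smoothOn N) (smoothOn N) :=
  Derivation.mk'
    -- Elements of `smoothOn N` are functions on the whole space, not classes modulo equality on
    -- `N`. The value zero outside `N` makes the Leibniz rule and the commutation relations genuine
    -- identities in the algebra.
    { toFun := fun φ => ⟨fun z => if z ∈ N then fderiv ℝ φ.1 z (X z) else 0, by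
        have h : ContDiffOn ℝ ∞ (fun z => fderiv ℝ φ.1 z (X z)) N :=
          (ContDiffOn.fderiv_of_isOpen φ.2 hN (by simp)).clm_apply hX
        exact h.congr fun z hz => by simp [hz]⟩
      map_add' := fun φ ψ => by
        ext z
        by_cases hz : z ∈ N
        · simp [hz, fderiv_add (smoothOn.differentiableAt hN φ hz)
            (smoothOn.differentiableAt hN ψ hz)]
        · simp [hz]
      map_smul' := fun r φ => by
        ext z
        by_cases hz : z ∈ N
        · simp [hz, fderiv_const_smul (smoothOn.differentiableAt hN φ hz)]
        · simp [hz] }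
    fun φ ψ => by
      ext z
      by_cases hz : z ∈ N
      · simp [hz, fderiv_mul (smoothOn.differentiableAt hN φ hz)
            (smoothOn.differentiableAt hN ψ hz)]
      · simp [hz]

variable (hN : IsOpen N) {X Y : P → P}
  (hX : ContDiffOn ℝ ∞ X N) (hY : ContDiffOn ℝ ∞ Y N)

theorem lieDer_apply (φ : smoothOn N) {z : P} (hz : z ∈ N) :
    (lieDer hN X hX φ).1 z = fderiv ℝ φ.1 z (X z) := by
  simp [lieDer, hz]

theorem lieDer_apply_of_notMem (φ : smoothOn N) {z : P} (hz : z ∉ N) :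
    (lieDer hN X hX φ).1 z = 0 := by
  simp [lieDer, hz]

theorem lieDer_lieDer (φ : smoothOn N) {z : P} (hz : z ∈ N) :
    (lieDer hN X hX (lieDer hN Y hY φ)).1 z
      = fderiv ℝ (fderiv ℝ φ.1) z (X z) (Y z) + fderiv ℝ φ.1 z (fderiv ℝ Y z (X z)) := by
  have hz' := hN.mem_nhds hz
  rw [lieDer_apply hN hX _ hz]
  have h : (lieDer hN Y hY φ).1 =ᶠ[𝓝 z] fun z => fderiv ℝ φ.1 z (Y z) := by
    filter_upwards [hz'] with w hw using lieDer_apply hN hY φ hw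
  have h1 : DifferentiableAt ℝ (fderiv ℝ φ.1) z :=
    ((ContDiffOn.fderiv_of_isOpen (m := ∞) φ.2 hN (by simp)).contDiffAt hz').differentiableAt
      (by simp)
  have h2 : DifferentiableAt ℝ Y z := (hY.contDiffAt hz').differentiableAt (by simp)
  rw [h.fderiv_eq, fderiv_clm_apply h1 h2]
  simp [add_comm]

theorem lieDer_comm (φ : smoothOn N) {z : P} (hz : z ∈ N) :
    (lieDer hN X hX (lieDer hN Y hY φ)).1 z
      = (lieDer hN Y hY (lieDer hN X hX φ)).1 z
        + fderiv ℝ φ.1 z (fderiv ℝ Y z (X z) - fderiv ℝ X z (Y z)) := by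
  have hs : IsSymmSndFDerivAt ℝ φ.1 z :=
    (ContDiffOn.contDiffAt φ.2 (hN.mem_nhds hz)).isSymmSndFDerivAt
      (by simpa using ENat.LEInfty.out)
  rw [lieDer_lieDer hN hX hY φ hz, lieDer_lieDer hN hY hX φ hz, hs.eq, map_sub]
  ring

/-- If the bracket of two fields is a third one, so is the commutator of the derivations. -/
theorem lieDer_comm_eq {Z : P → P} (hZ : ContDiffOn ℝ ∞ Z N)
    (h : ∀ z ∈ N, fderiv ℝ Y z (X z) - fderiv ℝ X z (Y z) = Z z) (φ : smoothOn N) :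
    lieDer hN X hX (lieDer hN Y hY φ) = lieDer hN Y hY (lieDer hN X hX φ) + lieDer hN Z hZ φ := by
  ext z
  by_cases hz : z ∈ N
  · rw [lieDer_comm hN hX hY φ hz, h z hz, Subalgebra.coe_add, Pi.add_apply,
      lieDer_apply hN hZ φ hz]
  · simp [lieDer_apply_of_notMem, hz]

end Calculus

end VSBM

end

noncomputable section

namespace VSBM

/-! ### Shortcut instances for spaces of bilinear maps -/

section Instances

variable {E F : Type*} [NormedAddCommGroup E] [NormedSpace ℝ E] [NormedAddCommGroup F]
  [NormedSpace ℝ F]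

instance normedAddCommGroup_clm : NormedAddCommGroup (E →L[ℝ] F) :=
  ContinuousLinearMap.toNormedAddCommGroup

instance normedSpace_clm : NormedSpace ℝ (E →L[ℝ] F) := ContinuousLinearMap.toNormedSpace

instance normedAddCommGroup_clm₂ : NormedAddCommGroup (E →L[ℝ] E →L[ℝ] F) :=
  ContinuousLinearMap.toNormedAddCommGroup

instance normedSpace_clm₂ : NormedSpace ℝ (E →L[ℝ] E →L[ℝ] F) :=
  ContinuousLinearMap.toNormedSpace

instance normedAddCommGroup_clm₃ : NormedAddCommGroup (E →L[ℝ] E →L[ℝ] E →L[ℝ] F) :=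
  ContinuousLinearMap.toNormedAddCommGroup

end Instances

/-! ### The fundamental fields in frame coordinates -/

/-- Coordinates of frames: a base point and `n` vectors. -/
abbrev FrameSpace (m : ℕ) (E : Type*) : Type _ := E × (Fin (m + 1) → E)

section Fields

variable {m : ℕ} {E : Type*} [NormedAddCommGroup E] [NormedSpace ℝ E]

/-- The `k`-th vector of a frame, as a linear map. -/
def frameProj (k : Fin (m + 1)) : FrameSpace m E →L[ℝ] E :=
  (ContinuousLinearMap.proj k).comp (ContinuousLinearMap.snd ℝ (E) (Fin (m + 1) → E))

@[simp]
theorem frameProj_apply (k : Fin (m + 1)) (z : FrameSpace m E) : frameProj k z = z.2 k := rfl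

theorem contDiff_frameProj (k : Fin (m + 1)) :
    ContDiff ℝ ∞ (fun z : FrameSpace m E => z.2 k) :=
  ContinuousLinearMap.contDiff (frameProj k : FrameSpace m E →L[ℝ] E)

theorem hasFDerivAt_frameProj (k : Fin (m + 1)) (z : FrameSpace m E) :
    HasFDerivAt (fun z : FrameSpace m E => z.2 k) (frameProj k) z :=
  ContinuousLinearMap.hasFDerivAt (frameProj k : FrameSpace m E →L[ℝ] E)

/-- The vertical field `∑ₖ e^a_k ∂/∂e^0_k - e^0_k ∂/∂e^a_k`; it vanishes for `a = 0`. -/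
def vertField (a : Fin (m + 1)) : FrameSpace m E →L[ℝ] FrameSpace m E :=
  ContinuousLinearMap.prod 0 (ContinuousLinearMap.pi fun k =>
    (if k = 0 then frameProj a else 0) - (if k = a then frameProj 0 else 0))

@[simp]
theorem vertField_fst (a : Fin (m + 1)) (z : FrameSpace m E) : (vertField a z).1 = 0 := rfl

@[simp]
theorem vertField_snd (a k : Fin (m + 1)) (z : FrameSpace m E) :
    (vertField a z).2 k = (if k = 0 then z.2 a else 0) - (if k = a then z.2 0 else 0) := by
  change ((if k = 0 then frameProj a else 0) - (if k = a then frameProj 0 else 0) :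
    FrameSpace m E →L[ℝ] E) z = _
  split_ifs <;> simp

theorem vertField_zero : vertField (E := E) (0 : Fin (m + 1)) = 0 := by
  refine ContinuousLinearMap.ext fun z => Prod.ext rfl (funext fun k => ?_)
  simp

/-- The bracket of two vertical fields is the infinitesimal rotation in the plane of `e^i`, `e^j`,
which leaves `e^0` fixed and so kills functions lifted from `T¹M`. -/
theorem vertField_comm_zero (i j : Fin m) (z : FrameSpace m E) :
    (vertField i.succ (vertField j.succ z) - vertField j.succ (vertField i.succ z)).2 0 = 0 := by
  simp [Fin.succ_ne_zero, eq_comm]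

/-- A relation of `so(n)`: the rotation of the plane `(e^i, e^j)` bracketed with that of `(e^0,
e^j)` restores that of `(e^0, e^i)`. The fields are linear, so brackets are commutators of linear
maps. Summation over `j ≠ i` is the source of the constant `n - 2`. -/
theorem vertField_double_bracket (i j : Fin m) (z : FrameSpace m E) :
    vertField j.succ (vertField i.succ (vertField j.succ z) - vertField j.succ (vertField i.succ z))
      - (vertField i.succ (vertField j.succ (vertField j.succ z))
        - vertField j.succ (vertField i.succ (vertField j.succ z)))
      = if i = j then 0 else vertField i.succ z := by
  have h0 : ∀ k : Fin m, (0 : Fin (m + 1)) ≠ k.succ := fun k => (Fin.succ_ne_zero k).symm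
  refine Prod.ext ?_ (funext fun k => ?_)
  · split_ifs <;> simp
  · by_cases hij : i = j
    · subst hij; simp
    · have hji : j ≠ i := fun h => hij h.symm
      induction k using Fin.cases with
      | zero => simp [hij, hji, h0, Fin.succ_ne_zero]
      | succ k =>
        by_cases hki : k = i
        · subst hki; simp [hij, h0, Fin.succ_ne_zero]
        · by_cases hkj : k = j
          · subst hkj; simp [hij, hji, h0, Fin.succ_ne_zero]
          · simp [hij, Fin.succ_ne_zero, hki, hkj]

variable (Γ : E → E →L[ℝ] E →L[ℝ] E)

/-- The horizontal lift of the vector `w` at the frame `z`. -/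
def horLift (z : FrameSpace m E) (w : E) : FrameSpace m E := (w, fun k => -Γ z.1 (z.2 k) w)

/-- The horizontal field `H_a`. -/
def horField (a : Fin (m + 1)) (z : FrameSpace m E) : FrameSpace m E := horLift Γ z (z.2 a)

/-- The curvature `R(X, Y)Z` of the connection with Christoffel symbols `Γ`. -/
def curv (y X Y Z : E) : E :=
  fderiv ℝ Γ y X Y Z - fderiv ℝ Γ y Y X Z + (Γ y X (Γ y Y Z) - Γ y Y (Γ y X Z))

variable {Γ} {W : Set (E)} (hW : IsOpen W) (hΓ : ContDiffOn ℝ ∞ Γ W)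

include hΓ in
theorem contDiffOn_horField {N : Set (FrameSpace m E)} (hNW : ∀ z ∈ N, z.1 ∈ W)
    (a : Fin (m + 1)) : ContDiffOn ℝ ∞ (horField Γ a) N := by
  have h1 : ContDiffOn ℝ ∞ (fun z : FrameSpace m E => Γ z.1) N :=
    hΓ.comp contDiffOn_fst hNW
  have h2 : ∀ k, ContDiffOn ℝ ∞ (fun z : FrameSpace m E => z.2 k) N := fun k =>
    (contDiff_frameProj k).contDiffOn
  exact (h2 a).prodMk (contDiffOn_pi.2 fun k => ((h1.clm_apply (h2 k)).clm_apply (h2 a)).neg)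

theorem contDiffOn_vertField {N : Set (FrameSpace m E)} (a : Fin (m + 1)) :
    ContDiffOn ℝ ∞ (vertField (E := E) a) N :=
  ContDiff.contDiffOn (ContinuousLinearMap.contDiff (vertField (E := E) a))

include hW hΓ in
theorem fderiv_horField (a : Fin (m + 1)) {z : FrameSpace m E} (hz : z.1 ∈ W) (v : FrameSpace m E) :
    fderiv ℝ (horField Γ a) z v = (v.2 a, fun k => -(fderiv ℝ Γ z.1 v.1 (z.2 k) (z.2 a)
      + Γ z.1 (v.2 k) (z.2 a) + Γ z.1 (z.2 k) (v.2 a))) := by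
  have h0 : HasFDerivAt Γ (fderiv ℝ Γ z.1) z.1 :=
    ((hΓ.contDiffAt (hW.mem_nhds hz)).differentiableAt (by simp)).hasFDerivAt
  have h1 : HasFDerivAt (fun z : FrameSpace m E => Γ z.1)
      ((fderiv ℝ Γ z.1).comp (ContinuousLinearMap.fst ℝ _ _)) z :=
    HasFDerivAt.comp (f := (Prod.fst : FrameSpace m E → E)) z h0 hasFDerivAt_fst
  have h2 : ∀ k, HasFDerivAt (fun z : FrameSpace m E => z.2 k) (frameProj k) z := fun k =>
    hasFDerivAt_frameProj k z
  have h3 := (h2 a).prodMk (hasFDerivAt_pi.2 fun k =>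
    ((h1.clm_apply (h2 k)).clm_apply (h2 a)).neg)
  rw [show fderiv ℝ (horField Γ a) z = _ from h3.fderiv]
  refine Prod.ext rfl (funext fun k => ?_)
  simp
  abel

include hW hΓ in
-- For fixed `w`, the lift `horLift Γ z w` commutes with linear recombinations of the frame vectors,
-- so the bracket sees only the dependence of `w = z.2 b` on the frame.
theorem bracket_vert_hor (a b : Fin (m + 1)) {z : FrameSpace m E} (hz : z.1 ∈ W) :
    fderiv ℝ (horField Γ b) z (vertField a z) - fderiv ℝ (vertField a) z (horField Γ b z)
      = horLift Γ z ((vertField a z).2 b) := by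
  rw [fderiv_horField hW hΓ b hz, ContinuousLinearMap.fderiv]
  refine Prod.ext ?_ (funext fun k => ?_)
  · simp [horLift]
  · simp only [Prod.snd_sub, Pi.sub_apply, horLift, horField, vertField_fst, map_zero, zero_apply,
      zero_add]
    generalize (vertField a z).2 b = w
    rw [vertField_snd, vertField_snd]
    split_ifs <;> simp only [map_sub, map_neg, map_zero, sub_apply, neg_apply, zero_apply, sub_zero,
      zero_sub] <;> abel

variable (hsymm : ∀ y ∈ W, ∀ v w, Γ y v w = Γ y w v)

include hW hΓ hsymm in
theorem fderiv_symm {y : E} (hy : y ∈ W) (u v w : E) :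
    fderiv ℝ Γ y u v w = fderiv ℝ Γ y u w v := by
  have h0 : DifferentiableAt ℝ Γ y :=
    (hΓ.contDiffAt (hW.mem_nhds hy)).differentiableAt (by simp)
  have h1 : ∀ v w, fderiv ℝ Γ y u v w = fderiv ℝ (fun y => Γ y v w) y u := by
    intro v w
    have h2 := ((h0.hasFDerivAt.clm_apply (hasFDerivAt_const v y)).clm_apply
      (hasFDerivAt_const w y)).fderiv
    rw [h2]
    simp
  have h3 : (fun y => Γ y v w) =ᶠ[𝓝 y] fun y => Γ y w v := by
    filter_upwards [hW.mem_nhds hy] with x hx using hsymm x hx v w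
  rw [h1, h1, h3.fderiv_eq]

include hW hΓ hsymm in
-- The base component cancels by torsion-freeness. The frame component is the curvature, its first
-- two arguments in the order `b`, `a` because of the minus sign in the horizontal lift.
theorem bracket_hor_hor (a b : Fin (m + 1)) {z : FrameSpace m E} (hz : z.1 ∈ W) :
    fderiv ℝ (horField Γ b) z (horField Γ a z) - fderiv ℝ (horField Γ a) z (horField Γ b z)
      = (0, fun k => curv Γ z.1 (z.2 b) (z.2 a) (z.2 k)) := by
  rw [fderiv_horField hW hΓ b hz, fderiv_horField hW hΓ a hz]
  refine Prod.ext ?_ (funext fun k => ?_)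
  · simp [horField, horLift, hsymm z.1 hz (z.2 a)]
  · simp only [horField, horLift, Prod.snd_sub, Pi.sub_apply, curv, map_neg,
      neg_apply]
    rw [fderiv_symm hW hΓ hsymm hz (z.2 a) (z.2 k), fderiv_symm hW hΓ hsymm hz (z.2 b) (z.2 k),
      hsymm z.1 hz (Γ z.1 (z.2 k) (z.2 a)), hsymm z.1 hz (Γ z.1 (z.2 k) (z.2 b)),
      hsymm z.1 hz (z.2 k) (z.2 a), hsymm z.1 hz (z.2 k) (z.2 b), hsymm z.1 hz (z.2 a) (z.2 b)]
    abel

/-! ### The derivations -/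

variable {N : Set (FrameSpace m E)} (hN : IsOpen N) (hNW : ∀ z ∈ N, z.1 ∈ W)

/-- The derivation along a vertical field. -/
def vertDer (a : Fin (m + 1)) : Derivation ℝ (smoothOn N) (smoothOn N) :=
  lieDer hN (vertField a) (contDiffOn_vertField a)

/-- The derivation along a horizontal field. -/
def horDer (a : Fin (m + 1)) : Derivation ℝ (smoothOn N) (smoothOn N) :=
  lieDer hN (horField Γ a) (contDiffOn_horField hΓ hNW a)

theorem vertDer_apply (a : Fin (m + 1)) (φ : smoothOn N) {z : FrameSpace m E} (hz : z ∈ N) :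
    (vertDer hN a φ).1 z = fderiv ℝ φ.1 z (vertField a z) := lieDer_apply hN _ φ hz

theorem horDer_apply (a : Fin (m + 1)) (φ : smoothOn N) {z : FrameSpace m E} (hz : z ∈ N) :
    (horDer hΓ hN hNW a φ).1 z = fderiv ℝ φ.1 z (horField Γ a z) := lieDer_apply hN _ φ hz

theorem vertDer_zero : vertDer (E := E) hN (0 : Fin (m + 1)) = 0 := by
  ext φ z
  by_cases hz : z ∈ N
  · simp [vertDer_apply hN _ _ hz, vertField_zero]
  · simp [vertDer, lieDer_apply_of_notMem, hz]

/-- A function which depends on the base point and the first vector of the frame only, to first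
order. -/
def DependsOnFirst (φ : smoothOn N) : Prop :=
  ∀ z ∈ N, ∀ v : FrameSpace m E, v.1 = 0 → v.2 0 = 0 → fderiv ℝ φ.1 z v = 0

include hW in
-- The relations between `V` and `H` are brackets of fields and hold for every `b`. `DependsOnFirst`
-- is needed for `vert_laplacian`, since `[V_i, V_j]` is not zero as a field. Here `ρ` is just the
-- commutator; its curvature form is computed separately.
theorem frameRelations {φ : smoothOn N} (hφ : DependsOnFirst φ) :
    FrameRelations (fun i : Fin m => vertDer hN i.succ) (horDer hΓ hN hNW) φ
      (fun i => horDer hΓ hN hNW 0 (horDer hΓ hN hNW i.succ φ)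
        - horDer hΓ hN hNW i.succ (horDer hΓ hN hNW 0 φ)) := by
  have h0 : ∀ k : Fin m, (0 : Fin (m + 1)) ≠ k.succ := fun k => (Fin.succ_ne_zero k).symm
  have hvv : ∀ i j : Fin m, vertDer hN i.succ (vertDer hN j.succ φ)
      = vertDer hN j.succ (vertDer hN i.succ φ) := by
    intro i j
    ext z
    by_cases hz : z ∈ N
    · have h := lieDer_comm hN (contDiffOn_vertField i.succ) (contDiffOn_vertField j.succ) φ hz
      rw [ContinuousLinearMap.fderiv, ContinuousLinearMap.fderiv, hφ z hz _ (by simp)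
        (vertField_comm_zero j i z), add_zero] at h
      exact h
    · simp [vertDer, lieDer_apply_of_notMem, hz]
  refine ⟨?_, ?_, ?_, fun i => rfl⟩
  · intro i b
    refine lieDer_comm_eq hN _ _ _ (fun z hz => ?_) b
    rw [bracket_vert_hor hW hΓ _ _ (hNW z hz)]
    simp [horField, h0]
  · intro i j b
    ext z
    by_cases hz : z ∈ N
    · have h := lieDer_comm hN (contDiffOn_vertField i.succ) (contDiffOn_horField hΓ hNW j.succ)
        b hz
      rw [bracket_vert_hor hW hΓ _ _ (hNW z hz)] at h
      by_cases hij : i = j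
      · subst hij
        have h1 : horLift Γ z ((vertField i.succ z).2 i.succ) = -horField Γ 0 z := by
          simp only [vertField_snd, horField, horLift]
          refine Prod.ext ?_ (funext fun k => ?_) <;> simp
        rw [h1, map_neg, ← horDer_apply hΓ hN hNW 0 b hz, ← sub_eq_add_neg] at h
        rw [if_pos rfl]
        exact h
      · have h1 : horLift Γ z ((vertField i.succ z).2 j.succ) = 0 := by
          have hji : ¬ j = i := fun h => hij h.symm
          simp only [vertField_snd, horLift]
          refine Prod.ext ?_ (funext fun k => ?_) <;> simp [hji]
        rw [h1, map_zero, add_zero] at h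
        rw [if_neg hij, sub_zero]
        exact h
    · have h1 : (horDer hΓ hN hNW 0 b).1 z = 0 := lieDer_apply_of_notMem hN _ _ hz
      split_ifs <;> simp [vertDer, horDer, lieDer_apply_of_notMem, hz]
  · intro i
    -- `V_j V_j V_i φ = V_j V_i V_j φ = V_i V_j V_j φ + [V_j, V_i] V_j φ`; as `[V_j, V_i] φ = 0`,
    -- the last term is the double bracket applied to `φ`.
    have key : ∀ j : Fin m, vertDer hN j.succ (vertDer hN j.succ (vertDer hN i.succ φ))
        = vertDer hN i.succ (vertDer hN j.succ (vertDer hN j.succ φ))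
          + if i = j then 0 else vertDer hN i.succ φ := by
      intro j
      rw [hvv j i]
      set Z : FrameSpace m E →L[ℝ] FrameSpace m E :=
        (vertField i.succ).comp (vertField j.succ) - (vertField j.succ).comp (vertField i.succ)
        with hZdef
      have hZ : ContDiffOn ℝ ∞ Z N := Z.contDiff.contDiffOn
      have h1 := lieDer_comm_eq hN (contDiffOn_vertField j.succ) (contDiffOn_vertField i.succ) hZ
        (fun z _ => by
          rw [ContinuousLinearMap.fderiv, ContinuousLinearMap.fderiv]; rfl) (vertDer hN j.succ φ)
      have h2 : lieDer hN Z hZ φ = 0 := by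
        ext z
        by_cases hz : z ∈ N
        · rw [lieDer_apply hN _ _ hz, hφ z hz _ (by simp [hZdef])]
          · rfl
          · exact vertField_comm_zero i j z
        · simp [lieDer_apply_of_notMem, hz]
      refine h1.trans ?_
      congr 1
      ext z
      by_cases hz : z ∈ N
      · have h3 := lieDer_comm hN hZ (contDiffOn_vertField j.succ) φ hz
        rw [h2, map_zero, ContinuousLinearMap.fderiv, ContinuousLinearMap.fderiv] at h3
        refine h3.trans ?_
        have h4 := vertField_double_bracket i j z
        have h5 : vertField j.succ (Z z) - Z (vertField j.succ z)
            = if i = j then 0 else vertField i.succ z := h4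
        rw [h5]
        split_ifs
        · simp
        · simp [vertDer_apply hN _ _ hz]
      · split_ifs <;> simp [vertDer, lieDer_apply_of_notMem, hz]
    simp only [key, Finset.sum_add_distrib, map_sum]
    rw [add_sub_cancel_left]
    have h6 : ∀ j : Fin m, (if i = j then 0 else vertDer hN i.succ φ)
        = vertDer hN i.succ φ - if i = j then vertDer hN i.succ φ else 0 := by
      intro j; split_ifs <;> simp
    simp only [h6, Finset.sum_sub_distrib, Finset.sum_const, Finset.sum_ite_eq, Finset.mem_univ,
      if_true, Finset.card_univ, Fintype.card_fin]
    module

end Fields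

end VSBM

end

noncomputable section

namespace VSBM

/-! ### Metric connections in a normed space -/

section Connection

variable {E : Type*} [NormedAddCommGroup E] [NormedSpace ℝ E]
  {W : Set E} {Γ : E → E →L[ℝ] E →L[ℝ] E} {g : E → E →L[ℝ] E →L[ℝ] ℝ}

/-- `Γ` gives the Christoffel symbols of a torsion free connection preserving the metric `g`. -/
structure IsLeviCivita (W : Set E) (g : E → E →L[ℝ] E →L[ℝ] ℝ) (Γ : E → E →L[ℝ] E →L[ℝ] E) :
    Prop where
  isOpen : IsOpen W
  contDiffOn_metric : ContDiffOn ℝ ∞ g W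
  contDiffOn : ContDiffOn ℝ ∞ Γ W
  metric_symm : ∀ y ∈ W, ∀ v w, g y v w = g y w v
  metric_pos : ∀ y ∈ W, ∀ v, v ≠ 0 → 0 < g y v v
  symm : ∀ y ∈ W, ∀ v w, Γ y v w = Γ y w v
  compat : ∀ y ∈ W, ∀ z v w, fderiv ℝ g y z v w = g y (Γ y z v) w + g y v (Γ y z w)

theorem curv_swap (y X Y Z : E) : curv Γ y X Y Z = -curv Γ y Y X Z := by
  simp only [curv]; abel

namespace IsLeviCivita

variable (h : IsLeviCivita W g Γ)

include h

theorem hasFDerivAt_metric {y : E} (hy : y ∈ W) : HasFDerivAt g (fderiv ℝ g y) y :=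
  ((h.contDiffOn_metric.contDiffAt (h.isOpen.mem_nhds hy)).differentiableAt (by simp)).hasFDerivAt

theorem hasFDerivAt {y : E} (hy : y ∈ W) : HasFDerivAt Γ (fderiv ℝ Γ y) y :=
  ((h.contDiffOn.contDiffAt (h.isOpen.mem_nhds hy)).differentiableAt (by simp)).hasFDerivAt

/-- First Bianchi identity: symmetry of `Γ` and of its derivative makes all terms cancel in pairs.
-/
theorem curv_bianchi {y : E} (hy : y ∈ W) (X Y Z : E) :
    curv Γ y X Y Z + curv Γ y Y Z X + curv Γ y Z X Y = 0 := by
  simp only [curv]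
  rw [fderiv_symm h.isOpen h.contDiffOn h.symm hy X Z Y,
    fderiv_symm h.isOpen h.contDiffOn h.symm hy Y X Z,
    fderiv_symm h.isOpen h.contDiffOn h.symm hy Z Y X,
    h.symm y hy X Z, h.symm y hy Y X, h.symm y hy Z Y]
  abel

/-- Metric compatibility differentiated once more. The left side is symmetric in `X`, `Y`, which
forces the skew-symmetry of the curvature below. -/
theorem second_fderiv_metric {y : E} (hy : y ∈ W) (X Y Z V : E) :
    fderiv ℝ (fderiv ℝ g) y X Y Z V
      = g y (Γ y X (Γ y Y Z)) V + g y (Γ y Y Z) (Γ y X V) + g y (fderiv ℝ Γ y X Y Z) V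
        + (g y (Γ y X Z) (Γ y Y V) + g y Z (Γ y X (Γ y Y V)) + g y Z (fderiv ℝ Γ y X Y V)) := by
  have h1 : HasFDerivAt (fderiv ℝ g) (fderiv ℝ (fderiv ℝ g) y) y :=
    (((h.contDiffOn_metric.fderiv_of_isOpen (m := ∞) h.isOpen (by simp)).contDiffAt
      (h.isOpen.mem_nhds hy)).differentiableAt (by simp)).hasFDerivAt
  have h2 := ((h1.clm_apply (hasFDerivAt_const Y y)).clm_apply (hasFDerivAt_const Z y)).clm_apply
    (hasFDerivAt_const V y)
  have hg := h.hasFDerivAt_metric hy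
  have hΓ := h.hasFDerivAt hy
  have hΓ' : ∀ U, HasFDerivAt (fun y => Γ y Y U) ((fderiv ℝ Γ y).flip Y |>.flip U) y := by
    intro U
    refine ((hΓ.clm_apply (hasFDerivAt_const Y y)).clm_apply
      (hasFDerivAt_const U y)).congr_fderiv ?_
    ext w
    simp
  have h3 := ((hg.clm_apply (hΓ' Z)).clm_apply (hasFDerivAt_const V y)).add
    ((hg.clm_apply (hasFDerivAt_const Z y)).clm_apply (hΓ' V))
  have h4 : (fun y => fderiv ℝ g y Y Z V) =ᶠ[𝓝 y]
      fun y => g y (Γ y Y Z) V + g y Z (Γ y Y V) := by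
    filter_upwards [h.isOpen.mem_nhds hy] with x hx using h.compat x hx Y Z V
  have h5 := congrArg (fun T => T X) (h2.unique (h3.congr_of_eventuallyEq h4))
  simp [h.compat y hy] at h5
  rw [h5]
  ring

theorem metric_curv_skew {y : E} (hy : y ∈ W) (X Y Z V : E) :
    g y (curv Γ y X Y Z) V = -g y (curv Γ y X Y V) Z := by
  have hs : IsSymmSndFDerivAt ℝ g y :=
    (h.contDiffOn_metric.contDiffAt (h.isOpen.mem_nhds hy)).isSymmSndFDerivAt
      (by simpa using ENat.LEInfty.out)
  have h1 := congrArg (fun T => T Z V) (hs.eq X Y)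
  simp only [h.second_fderiv_metric hy] at h1
  rw [h.metric_symm y hy _ Z]
  simp only [curv, map_add, map_sub, add_apply, sub_apply]
  linarith

/-- The classical octahedron argument: four Bianchi identities combined with the two
skew-symmetries. -/
theorem metric_curv_pair {y : E} (hy : y ∈ W) (X Y Z V : E) :
    g y (curv Γ y X Y Z) V = g y (curv Γ y Z V X) Y := by
  have hb : ∀ X Y Z V, g y (curv Γ y X Y Z) V + g y (curv Γ y Y Z X) V
      + g y (curv Γ y Z X Y) V = 0 := by
    intro X Y Z V
    rw [← add_apply, ← add_apply, ← map_add, ← map_add, h.curv_bianchi hy, map_zero, zero_apply]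
  have hs : ∀ X Y Z V, g y (curv Γ y X Y Z) V = -g y (curv Γ y X Y V) Z :=
    h.metric_curv_skew hy
  have ha : ∀ X Y Z V, g y (curv Γ y X Y Z) V = -g y (curv Γ y Y X Z) V := by
    intro X Y Z V
    rw [curv_swap, map_neg, neg_apply]
  have b1 := hb X Y Z V
  have b2 := hb Y Z V X
  have b3 := hb Z V X Y
  have b4 := hb V X Y Z
  linarith [hs X Y Z V, hs Y Z X V, hs Z X Y V, hs Z V X Y, hs V X Z Y, hs X Z Y V, hs Y V Z X,
    ha X Y Z V, ha Y Z X V, ha Z X Y V, ha Z V X Y, ha V X Y Z, ha X Y V Z, ha Y V X Z, ha V Y Z X,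
    ha X Z V Y, ha Z V Y X, ha Y Z V X, ha V X Z Y, ha V Y X Z, hs V Y X Z, hs Y Z V X]

theorem jacobi_symm {y : E} (hy : y ∈ W) (X Y Z : E) :
    g y (curv Γ y X Y Y) Z = g y (curv Γ y Z Y Y) X := by
  rw [h.metric_curv_pair hy X Y Y Z, curv_swap, map_neg, neg_apply, h.metric_curv_skew hy Z Y X Y,
    neg_neg]

/-- Hence `R(e^i, e^0)e^0` has no component along `e^0`, and its action on `e^0` is a combination of
the `V_j`. -/
theorem jacobi_self {y : E} (hy : y ∈ W) (X Y : E) : g y (curv Γ y X Y Y) Y = 0 := by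
  have := h.metric_curv_skew hy X Y Y Y
  linarith

/-- The horizontal lift is tangent to the orthonormal frames. -/
theorem horLift_tangent {m : ℕ} {z : FrameSpace m E} (hz : z.1 ∈ W) (w : E) (k l : Fin (m + 1)) :
    fderiv ℝ g z.1 (horLift Γ z w).1 (z.2 k) (z.2 l) + g z.1 ((horLift Γ z w).2 k) (z.2 l)
      + g z.1 (z.2 k) ((horLift Γ z w).2 l) = 0 := by
  simp only [horLift, h.compat z.1 hz, map_neg, neg_apply, h.symm z.1 hz _ w]
  ring

/-- Uniqueness of the Levi-Civita connection: the transformation law under a change of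
coordinates `τ`. -/
theorem transform {W' : Set E} {g' : E → E →L[ℝ] E →L[ℝ] ℝ} {Γ' : E → E →L[ℝ] E →L[ℝ] E}
    (h' : IsLeviCivita W' g' Γ') {τ : E → E} {y : E} (hy' : y ∈ W') (hy : τ y ∈ W)
    (hτ : ContDiffAt ℝ ∞ τ y) (hsurj : Function.Surjective (fderiv ℝ τ y))
    (hg : ∀ᶠ x in 𝓝 y, ∀ v w, g' x v w = g (τ x) (fderiv ℝ τ x v) (fderiv ℝ τ x w)) (v w : E) :
    fderiv ℝ τ y (Γ' y v w)
      = fderiv ℝ (fderiv ℝ τ) y v w + Γ (τ y) (fderiv ℝ τ y v) (fderiv ℝ τ y w) := by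
  have hs : IsSymmSndFDerivAt ℝ τ y := hτ.isSymmSndFDerivAt (by simpa using ENat.LEInfty.out)
  have h1 : HasFDerivAt τ (fderiv ℝ τ y) y := (hτ.differentiableAt (by simp)).hasFDerivAt
  have h2 : HasFDerivAt (fderiv ℝ τ) (fderiv ℝ (fderiv ℝ τ) y) y :=
    ((hτ.fderiv_right (m := ∞) (by simp)).differentiableAt
      (by simp)).hasFDerivAt
  have hgτ := HasFDerivAt.comp (g := g) (f := τ) y (h.hasFDerivAt_metric hy) h1
  -- The defect of the transformation law is symmetric in its arguments, and pairing it with the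
  -- metric gives a form skew in the last two, both connections being metric. A trilinear form with
  -- these two symmetries vanishes, as in the uniqueness part of Koszul's argument.
  set T : E → E → E := fun v w => fderiv ℝ τ y (Γ' y v w)
    - (fderiv ℝ (fderiv ℝ τ) y v w + Γ (τ y) (fderiv ℝ τ y v) (fderiv ℝ τ y w)) with hT
  have hTs : ∀ v w, T v w = T w v := by
    intro v w
    simp only [hT, h'.symm y hy' v w, hs.eq v w, h.symm _ hy (fderiv ℝ τ y v)]
  have hTa : ∀ u v w, g (τ y) (T u v) (fderiv ℝ τ y w) = -g (τ y) (T u w) (fderiv ℝ τ y v) := by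
    intro u v w
    have h3 := (((h'.hasFDerivAt_metric hy').clm_apply (hasFDerivAt_const v y)).clm_apply
      (hasFDerivAt_const w y))
    have h4 := (hgτ.clm_apply (h2.clm_apply (hasFDerivAt_const v y))).clm_apply
      (h2.clm_apply (hasFDerivAt_const w y))
    have h5 := h3.unique (h4.congr_of_eventuallyEq (hg.mono fun x hx => hx v w))
    have h6 := congrArg (fun S => S u) h5
    simp [h.compat _ hy, h'.compat _ hy', hg.self_of_nhds] at h6
    rw [h.metric_symm _ hy (T u w)]
    simp only [hT, map_add, map_sub, add_apply, sub_apply]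
    linarith
  have hT0 : ∀ u v w, g (τ y) (T u v) (fderiv ℝ τ y w) = 0 := by
    intro u v w
    have e1 := hTa u v w
    rw [hTs u w, hTa w u v, hTs w v, hTa v w u, hTs v u] at e1
    linarith
  -- Surjectivity allows the defect to be paired with itself, so positivity of the metric kills it.
  obtain ⟨w', hw'⟩ := hsurj (T v w)
  have h7 := hT0 v w w'
  rw [hw'] at h7
  by_contra hne
  have h8 := h.metric_pos _ hy (T v w) (sub_ne_zero.2 hne)
  linarith

end IsLeviCivita

end Connection

end VSBM

end

noncomputable section

namespace VSBM

/-! ### Tangent vectors in a chart -/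

section Chart

variable {m : ℕ} {M : Type*} [TopologicalSpace M] [ChartedSpace (Mod m) M]

/-- The domain of the coordinates given by the chart around `c`. -/
def chartDom (c : M) : Set (Mod m) := (extChartAt (𝓡 (m + 1)) c).target

theorem isOpen_chartDom (c : M) : IsOpen (chartDom (m := m) c) := isOpen_extChartAt_target c

theorem ptOf_mem {c : M} {y : Mod m} (hy : y ∈ chartDom c) :
    ptOf c y ∈ (extChartAt (𝓡 (m + 1)) c).source := (extChartAt (𝓡 (m + 1)) c).map_target hy

theorem ptOf_mem_chart {c : M} {y : Mod m} (hy : y ∈ chartDom c) :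
    ptOf c y ∈ (chartAt (Mod m) c).source := by
  have h := ptOf_mem hy
  rwa [extChartAt_source] at h

theorem ext_ptOf {c : M} {y : Mod m} (hy : y ∈ chartDom c) :
    extChartAt (𝓡 (m + 1)) c (ptOf c y) = y := (extChartAt (𝓡 (m + 1)) c).right_inv hy

theorem ptOf_ext {c x : M} (hx : x ∈ (extChartAt (𝓡 (m + 1)) c).source) :
    ptOf c (extChartAt (𝓡 (m + 1)) c x) = x := (extChartAt (𝓡 (m + 1)) c).left_inv hx

theorem ext_mem {c x : M} (hx : x ∈ (extChartAt (𝓡 (m + 1)) c).source) :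
    extChartAt (𝓡 (m + 1)) c x ∈ chartDom c := (extChartAt (𝓡 (m + 1)) c).map_source hx

theorem coords_add (c x : M) (X Y : TangentSpace (𝓡 (m + 1)) x) :
    coords c x (X + Y) = coords c x X + coords c x Y := map_add _ _ _

theorem coords_smul (c x : M) (r : ℝ) (X : TangentSpace (𝓡 (m + 1)) x) :
    coords c x (r • X) = r • coords c x X := map_smul _ _ _

/-- `coords` as a linear map. -/
def coordsL (c x : M) : TangentSpace (𝓡 (m + 1)) x →ₗ[ℝ] Mod m where
  toFun := coords c x
  map_add' := coords_add c x
  map_smul' := coords_smul c x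

@[simp]
theorem coordsL_apply (c x : M) (X : TangentSpace (𝓡 (m + 1)) x) :
    coordsL c x X = coords c x X := rfl

/-- `vecOf` as a linear map. -/
def vecOfL (c x : M) : Mod m →ₗ[ℝ] TangentSpace (𝓡 (m + 1)) x where
  toFun := vecOf c x
  map_add' v w := map_add ((mfderiv (𝓡 (m + 1)) 𝓘(ℝ, Mod m)
    (extChartAt (𝓡 (m + 1)) c) x).inverse) v w
  map_smul' r v := map_smul ((mfderiv (𝓡 (m + 1)) 𝓘(ℝ, Mod m)
    (extChartAt (𝓡 (m + 1)) c) x).inverse) r v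

@[simp]
theorem vecOfL_apply (c x : M) (v : Mod m) : vecOfL c x v = vecOf c x v := rfl

/-- The change of coordinates between the charts around `c'` and `c`. -/
def transMap (c' c : M) (y : Mod m) : Mod m := extChartAt (𝓡 (m + 1)) c (ptOf c' y)

theorem isOpen_transDom (c' c : M) :
    IsOpen (chartDom c' ∩ ptOf (m := m) c' ⁻¹' (extChartAt (𝓡 (m + 1)) c).source) :=
  (continuousOn_extChartAt_symm c').isOpen_inter_preimage (isOpen_chartDom c')
    (isOpen_extChartAt_source c)

theorem eventually_transDom {c' c : M} {y : Mod m} (hy : y ∈ chartDom c')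
    (hc : ptOf c' y ∈ (extChartAt (𝓡 (m + 1)) c).source) :
    ∀ᶠ x in 𝓝 y, x ∈ chartDom c' ∧ ptOf c' x ∈ (extChartAt (𝓡 (m + 1)) c).source :=
  (isOpen_transDom c' c).mem_nhds ⟨hy, hc⟩

variable [IsManifold (𝓡 (m + 1)) ∞ M]

theorem coords_vecOf {c x : M} (hx : x ∈ (extChartAt (𝓡 (m + 1)) c).source) (v : Mod m) :
    coords c x (vecOf c x v) = v := by
  have h := (isInvertible_mfderiv_extChartAt (I := 𝓡 (m + 1)) hx).self_comp_inverse
  exact congrArg (fun T => T v) h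

theorem vecOf_coords {c x : M} (hx : x ∈ (extChartAt (𝓡 (m + 1)) c).source)
    (X : TangentSpace (𝓡 (m + 1)) x) : vecOf c x (coords c x X) = X := by
  have h := (isInvertible_mfderiv_extChartAt (I := 𝓡 (m + 1)) hx).inverse_comp_self
  exact congrArg (fun T => T X) h

/-- The trivialization of the tangent bundle at `c` is the derivative of the chart around `c`; this
links `vecOf` to the smooth structure of `TM`. -/
theorem trivializationAt_vecOf {c x : M} (hx : x ∈ (chartAt (Mod m) c).source) (v : Mod m) :
    (trivializationAt (Mod m) (TangentSpace (𝓡 (m + 1))) c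
      (⟨x, vecOf c x v⟩ : TangentBundle (𝓡 (m + 1)) M)).2 = v := by
  have h := TangentBundle.continuousLinearMapAt_trivializationAt (I := 𝓡 (m + 1)) hx
  have h2 := congrArg (fun T => T (vecOf c x v)) h
  have h3 : coords c x (vecOf c x v) = v := coords_vecOf (by rwa [extChartAt_source]) v
  have h4 := h2.trans h3
  exact (Trivialization.continuousLinearMapAt_apply_of_mem (R := ℝ)
    (trivializationAt (Mod m) (TangentSpace (𝓡 (m + 1))) c) hx _).symm.trans h4

theorem contMDiffOn_ptOf (c : M) :
    ContMDiffOn 𝓘(ℝ, Mod m) (𝓡 (m + 1)) ∞ (ptOf (m := m) c) (chartDom c) :=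
  contMDiffOn_extChartAt_symm c

/-- The inverse of the chart of the tangent bundle is smooth. -/
theorem contMDiffAt_vecOf {c : M} {p : Mod m × Mod m} (hp : p.1 ∈ chartDom c) :
    ContMDiffAt 𝓘(ℝ, Mod m × Mod m) (𝓡 (m + 1)).tangent ∞
      (fun p : Mod m × Mod m =>
        (⟨ptOf c p.1, vecOf c (ptOf c p.1) p.2⟩ : TangentBundle (𝓡 (m + 1)) M)) p := by
  have h1 : ContMDiffAt 𝓘(ℝ, Mod m × Mod m) (𝓡 (m + 1)) ∞
      (fun p : Mod m × Mod m => ptOf c p.1) p :=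
    ContMDiffAt.comp p
      ((contMDiffOn_ptOf c).contMDiffAt ((isOpen_chartDom c).mem_nhds hp))
      contDiffAt_fst.contMDiffAt
  refine contMDiffAt_totalSpace.2 ⟨h1, ?_⟩
  have h2 := Bundle.Trivialization.contMDiffWithinAt_snd_comp_iff₂ (IB := 𝓡 (m + 1)) (n := ∞)
    (e := trivializationAt (Mod m) (TangentSpace (𝓡 (m + 1))) (ptOf c p.1))
    (e' := trivializationAt (Mod m) (TangentSpace (𝓡 (m + 1))) c)
    (f := fun p : Mod m × Mod m =>
        (⟨ptOf c p.1, vecOf c (ptOf c p.1) p.2⟩ : TangentBundle (𝓡 (m + 1)) M))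
    (s := Set.univ) (x := p) (IM := 𝓘(ℝ, Mod m × Mod m)) h1
    (by
      rw [TangentBundle.trivializationAt_source]
      exact mem_chart_source (Mod m) (ptOf c p.1))
    (by
      rw [TangentBundle.trivializationAt_source]
      exact ptOf_mem_chart hp)
  refine h2.2 ?_
  rw [contMDiffWithinAt_univ]
  refine ContMDiffAt.congr_of_eventuallyEq (contDiffAt_snd.contMDiffAt) ?_
  filter_upwards [((isOpen_chartDom c).preimage continuous_fst).mem_nhds hp] with q hq
  exact trivializationAt_vecOf (ptOf_mem_chart hq) q.2

theorem contDiffAt_transMap {c' c : M} {y : Mod m} (hy : y ∈ chartDom c')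
    (hc : ptOf c' y ∈ (extChartAt (𝓡 (m + 1)) c).source) : ContDiffAt ℝ ∞ (transMap c' c) y := by
  have h1 : ContMDiffAt 𝓘(ℝ, Mod m) (𝓡 (m + 1)) ∞ (ptOf c') y :=
    (contMDiffOn_ptOf c').contMDiffAt ((isOpen_chartDom c').mem_nhds hy)
  have h2 : ContMDiffAt (𝓡 (m + 1)) 𝓘(ℝ, Mod m) ∞ (extChartAt (𝓡 (m + 1)) c) (ptOf c' y) :=
    contMDiffAt_extChartAt' (by rwa [extChartAt_source] at hc)
  exact (ContMDiffAt.comp y h2 h1).contDiffAt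

theorem coords_trans {c' c : M} {y : Mod m} (hy : y ∈ chartDom c')
    (hc : ptOf c' y ∈ (extChartAt (𝓡 (m + 1)) c).source)
    (X : TangentSpace (𝓡 (m + 1)) (ptOf c' y)) :
    coords c (ptOf c' y) X = fderiv ℝ (transMap c' c) y (coords c' (ptOf c' y) X) := by
  have hc' := ptOf_mem hy
  have h1 : MDifferentiableAt (𝓡 (m + 1)) 𝓘(ℝ, Mod m) (extChartAt (𝓡 (m + 1)) c') (ptOf c' y) :=
    mdifferentiableAt_extChartAt (by rwa [extChartAt_source] at hc')
  have h2 : MDifferentiableAt 𝓘(ℝ, Mod m) 𝓘(ℝ, Mod m) (transMap c' c)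
      (extChartAt (𝓡 (m + 1)) c' (ptOf c' y)) := by
    rw [ext_ptOf hy]
    exact ((contDiffAt_transMap hy hc).differentiableAt (by simp)).mdifferentiableAt
  have h3 := mfderiv_comp (ptOf c' y) h2 h1
  have h4 : (transMap c' c) ∘ (extChartAt (𝓡 (m + 1)) c') =ᶠ[𝓝 (ptOf c' y)]
      extChartAt (𝓡 (m + 1)) c := by
    filter_upwards [(isOpen_extChartAt_source c').mem_nhds hc'] with x hx
    simp only [Function.comp_apply, transMap, ptOf_ext hx]
  rw [h4.mfderiv_eq, mfderiv_eq_fderiv, ext_ptOf hy] at h3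
  exact congrArg (fun T => T X) h3

theorem coords_change {c' c x : M} (hc' : x ∈ (extChartAt (𝓡 (m + 1)) c').source)
    (hc : x ∈ (extChartAt (𝓡 (m + 1)) c).source) (X : TangentSpace (𝓡 (m + 1)) x) :
    coords c x X
      = fderiv ℝ (transMap c' c) (extChartAt (𝓡 (m + 1)) c' x) (coords c' x X) := by
  obtain ⟨y, hy, rfl⟩ : ∃ y ∈ chartDom (m := m) c', ptOf c' y = x :=
    ⟨_, ext_mem hc', ptOf_ext hc'⟩
  rw [coords_trans hy hc, ext_ptOf hy]

theorem surjective_fderiv_transMap {c' c : M} {y : Mod m} (hy : y ∈ chartDom c')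
    (hc : ptOf c' y ∈ (extChartAt (𝓡 (m + 1)) c).source) :
    Function.Surjective (fderiv ℝ (transMap c' c) y) := by
  intro v
  refine ⟨coords c' (ptOf c' y) (vecOf c (ptOf c' y) v), ?_⟩
  rw [← coords_trans hy hc, coords_vecOf hc]

end Chart

end VSBM

end

noncomputable section

namespace VSBM

/-! ### Entries of the inverse of a smooth matrix -/

section Matrix

variable {P ι : Type*} [NormedAddCommGroup P] [NormedSpace ℝ P] [Fintype ι] [DecidableEq ι]
  {W : Set P}

theorem contDiffOn_det {A : P → Matrix ι ι ℝ} (hA : ∀ i j, ContDiffOn ℝ ∞ (fun y => A y i j) W) :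
    ContDiffOn ℝ ∞ (fun y => (A y).det) W := by
  simp only [Matrix.det_apply]
  exact ContDiffOn.sum fun σ _ => (contDiffOn_prod fun i _ => hA _ _).const_smul _

theorem contDiffOn_inv {A : P → Matrix ι ι ℝ} (hA : ∀ i j, ContDiffOn ℝ ∞ (fun y => A y i j) W)
    (hdet : ∀ y ∈ W, (A y).det ≠ 0) (i j : ι) : ContDiffOn ℝ ∞ (fun y => (A y)⁻¹ i j) W := by
  -- Cramer's rule: the entry is a quotient of determinants, polynomial in the entries of `A`.
  have h1 : ∀ y, (A y)⁻¹ i j = ((A y).det)⁻¹ * ((A y).updateRow j (Pi.single i 1)).det := by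
    intro y
    rw [Matrix.inv_def, Matrix.smul_apply, Matrix.adjugate_apply, Ring.inverse_eq_inv', smul_eq_mul]
  simp only [h1]
  refine ((contDiffOn_det hA).inv hdet).mul (contDiffOn_det fun k l => ?_)
  by_cases hk : k = j
  · subst hk
    simp only [Matrix.updateRow_self]
    exact contDiffOn_const
  · simp only [Matrix.updateRow_ne hk]
    exact hA k l

end Matrix

/-! ### The metric and the Christoffel symbols as multilinear maps -/

section Metric

variable {m : ℕ}

/-- The `i`-th coordinate. -/
def coordFn (i : Fin (m + 1)) : Mod m →L[ℝ] ℝ := EuclideanSpace.proj i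

@[simp]
theorem coordFn_apply (i : Fin (m + 1)) (v : Mod m) : coordFn i v = v i := rfl

theorem sum_bvec (v : Mod m) : ∑ i, v i • bvec i = v := by
  ext k
  simp [bvec, Pi.single_apply]

theorem bvec_apply (i j : Fin (m + 1)) : (bvec i : Mod m) j = if j = i then 1 else 0 := by
  simp [bvec]

theorem fderiv_eq_sum_pd (h : Mod m → ℝ) (y z : Mod m) :
    fderiv ℝ h y z = ∑ i, z i * pd i h y := by
  conv_lhs => rw [← sum_bvec z]
  simp [pd]

variable {M : Type*} [TopologicalSpace M] [ChartedSpace (Mod m) M]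
  [RiemannianBundle (fun x : M => TangentSpace (𝓡 (m + 1)) x)]

/-- The metric in the chart around `c`, as a bilinear map. -/
def metric (c : M) (y : Mod m) : Mod m →L[ℝ] Mod m →L[ℝ] ℝ :=
  ∑ i, ∑ j, metricMat c y i j • (coordFn i).smulRight (coordFn j)

/-- The Christoffel symbols in the chart around `c`, as a bilinear map. -/
def chris (c : M) (y : Mod m) : Mod m →L[ℝ] Mod m →L[ℝ] Mod m :=
  ∑ l, ∑ i, ∑ j, christoffel c l i j y • (coordFn i).smulRight ((coordFn j).smulRight (bvec l))

theorem metric_eq_sum (c : M) (y v w : Mod m) :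
    metric c y v w = ∑ i, ∑ j, metricMat c y i j * v i * w j := by
  simp [metric, mul_assoc]

theorem chris_apply (c : M) (y v w : Mod m) (l : Fin (m + 1)) :
    chris c y v w l = ∑ i, ∑ j, christoffel c l i j y * v i * w j := by
  simp [chris, bvec_apply, mul_assoc]

theorem metric_apply (c : M) (y v w : Mod m) :
    metric c y v w = ⟪vecOf c (ptOf c y) v, vecOf c (ptOf c y) w⟫_ℝ := by
  rw [metric_eq_sum]
  conv_rhs => rw [← vecOfL_apply, ← vecOfL_apply, ← sum_bvec v, ← sum_bvec w]
  simp only [map_sum, map_smul, sum_inner, inner_sum, real_inner_smul_left, real_inner_smul_right,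
    metricMat, Matrix.of_apply, vecOfL_apply]
  rw [Finset.sum_comm]
  exact Finset.sum_congr rfl fun i _ => Finset.sum_congr rfl fun j _ => by ring

theorem metricMat_symm (c : M) (y : Mod m) (i j : Fin (m + 1)) :
    metricMat c y i j = metricMat c y j i := by
  simp only [metricMat, Matrix.of_apply]
  exact real_inner_comm _ _

theorem christoffel_symm (c : M) (l i j : Fin (m + 1)) (y : Mod m) :
    christoffel c l i j y = christoffel c l j i y := by
  have h : (fun z => metricMat c z i j) = fun z => metricMat c z j i :=
    funext fun z => metricMat_symm c z i j
  simp only [christoffel, h]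
  congr 1
  exact Finset.sum_congr rfl fun k _ => by ring

variable [IsManifold (𝓡 (m + 1)) ∞ M]

theorem metric_coords {c x : M} (hx : x ∈ (extChartAt (𝓡 (m + 1)) c).source)
    (X Y : TangentSpace (𝓡 (m + 1)) x) :
    metric c (extChartAt (𝓡 (m + 1)) c x) (coords c x X) (coords c x Y) = ⟪X, Y⟫_ℝ := by
  rw [metric_apply, ptOf_ext hx, vecOf_coords hx, vecOf_coords hx]

theorem metric_pos (c : M) {y : Mod m} (hy : y ∈ chartDom c) {v : Mod m} (hv : v ≠ 0) :
    0 < metric c y v v := by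
  rw [metric_apply, real_inner_self_eq_norm_sq]
  have h : vecOf c (ptOf c y) v ≠ 0 := by
    intro h0
    have h1 := coords_vecOf (ptOf_mem hy) v
    rw [h0, ← coordsL_apply, map_zero] at h1
    exact hv h1.symm
  positivity

theorem metricMat_det_ne_zero (c : M) {y : Mod m} (hy : y ∈ chartDom c) :
    (metricMat c y).det ≠ 0 := by
  intro hdet
  obtain ⟨v, hv, hv0⟩ := Matrix.exists_mulVec_eq_zero_iff.2 hdet
  have h1 := metric_pos c hy (v := WithLp.toLp 2 v) (fun h => hv (by
    funext i
    exact congrArg (fun u : Mod m => u i) h))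
  rw [metric_eq_sum] at h1
  have h2 : ∀ i, ∑ j, metricMat c y i j * v j = 0 := fun i => congrFun hv0 i
  have h3 : ∑ i, ∑ j, metricMat c y i j * v i * v j = 0 := by
    refine Finset.sum_eq_zero fun i _ => ?_
    have := congrArg (fun r => v i * r) (h2 i)
    rw [mul_zero, Finset.mul_sum] at this
    rw [← this]
    exact Finset.sum_congr rfl fun j _ => by ring
  exact h1.ne' h3

/-- The Christoffel symbols with lowered index. -/
theorem sum_metricMat_christoffel (c : M) {y : Mod m} (hy : y ∈ chartDom c)
    (k i j : Fin (m + 1)) :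
    ∑ l, metricMat c y k l * christoffel c l i j y
      = 1 / 2 * (pd i (fun z => metricMat c z j k) y + pd j (fun z => metricMat c z i k) y
        - pd k (fun z => metricMat c z i j) y) := by
  set b : Fin (m + 1) → ℝ := fun k => pd i (fun z => metricMat c z j k) y
    + pd j (fun z => metricMat c z i k) y - pd k (fun z => metricMat c z i j) y with hb
  have h1 : (metricMat c y).mulVec ((metricMat c y)⁻¹.mulVec b) = b := by
    rw [Matrix.mulVec_mulVec, Matrix.mul_nonsing_inv _ (metricMat_det_ne_zero c hy).isUnit,
      Matrix.one_mulVec]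
  have h2 := congrFun h1 k
  change _ = 1 / 2 * b k
  rw [← h2]
  simp only [Matrix.mulVec, dotProduct, christoffel, Finset.mul_sum]
  refine Finset.sum_congr rfl fun l _ => Finset.sum_congr rfl fun p _ => ?_
  rw [hb]
  ring

/-- Koszul's formula: lowering the index removes the inverse matrix, so compatibility becomes a
cancellation between derivatives of the metric. -/
theorem metric_chris (c : M) {y : Mod m} (hy : y ∈ chartDom c) (z v w : Mod m) :
    metric c y (chris c y z v) w = ∑ k, ∑ i, ∑ j, 1 / 2 *
      (pd i (fun z => metricMat c z j k) y + pd j (fun z => metricMat c z i k) y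
        - pd k (fun z => metricMat c z i j) y) * z i * v j * w k := by
  rw [metric_eq_sum, Finset.sum_comm]
  refine Finset.sum_congr rfl fun k _ => ?_
  simp only [← sum_metricMat_christoffel c hy, chris_apply, Finset.mul_sum, Finset.sum_mul]
  rw [Finset.sum_comm]
  refine Finset.sum_congr rfl fun i _ => ?_
  rw [Finset.sum_comm]
  refine Finset.sum_congr rfl fun j _ => Finset.sum_congr rfl fun l _ => ?_
  rw [metricMat_symm c y l k]
  ring

variable [IsContMDiffRiemannianBundle (𝓡 (m + 1)) ∞ (Mod m)
      (fun x : M => TangentSpace (𝓡 (m + 1)) x)]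

theorem contDiffOn_metricMat (c : M) (i j : Fin (m + 1)) :
    ContDiffOn ℝ ∞ (fun y => metricMat c y i j) (chartDom c) := by
  intro y hy
  have h : ∀ v : Mod m, ContMDiffAt 𝓘(ℝ, Mod m) (𝓡 (m + 1)).tangent ∞
      (fun y : Mod m => (⟨ptOf c y, vecOf c (ptOf c y) v⟩ : TangentBundle (𝓡 (m + 1)) M)) y := by
    intro v
    exact ContMDiffAt.comp y (contMDiffAt_vecOf (c := c) (p := (y, v)) hy)
      (contDiffAt_id.prodMk contDiffAt_const).contMDiffAt
  exact (ContMDiffAt.inner_bundle (h (bvec i)) (h (bvec j))).contDiffAt.contDiffWithinAt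

theorem contDiffOn_metric (c : M) : ContDiffOn ℝ ∞ (metric (m := m) c) (chartDom c) :=
  ContDiffOn.sum fun i _ => ContDiffOn.sum fun j _ =>
    (contDiffOn_metricMat c i j).smul contDiffOn_const

theorem contDiffOn_pd_metricMat (c : M) (k i j : Fin (m + 1)) :
    ContDiffOn ℝ ∞ (pd k fun y => metricMat c y i j) (chartDom c) :=
  ((contDiffOn_metricMat c i j).fderiv_of_isOpen (isOpen_chartDom c) (by simp)).clm_apply
    contDiffOn_const

theorem contDiffOn_christoffel (c : M) (l i j : Fin (m + 1)) :
    ContDiffOn ℝ ∞ (christoffel c l i j) (chartDom c) :=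
  contDiffOn_const.mul (ContDiffOn.sum fun k _ =>
    (contDiffOn_inv (contDiffOn_metricMat c) (fun _ hy => metricMat_det_ne_zero c hy) l k).mul
      (((contDiffOn_pd_metricMat c i j k).add (contDiffOn_pd_metricMat c j i k)).sub
        (contDiffOn_pd_metricMat c k i j)))

theorem contDiffOn_chris (c : M) : ContDiffOn ℝ ∞ (chris (m := m) c) (chartDom c) :=
  ContDiffOn.sum fun l _ => ContDiffOn.sum fun i _ => ContDiffOn.sum fun j _ =>
    (contDiffOn_christoffel c l i j).smul contDiffOn_const

theorem fderiv_metric (c : M) {y : Mod m} (hy : y ∈ chartDom c) (z v w : Mod m) :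
    fderiv ℝ (metric c) y z v w
      = ∑ k, ∑ i, ∑ j, pd i (fun z => metricMat c z j k) y * z i * v j * w k := by
  have h0 : DifferentiableAt ℝ (metric c) y :=
    ((contDiffOn_metric c).contDiffAt ((isOpen_chartDom c).mem_nhds hy)).differentiableAt (by simp)
  have h1 : HasFDerivAt (fun y => metric c y v w) (((fderiv ℝ (metric c) y).flip v).flip w) y := by
    refine ((h0.hasFDerivAt.clm_apply (hasFDerivAt_const v y)).clm_apply
      (hasFDerivAt_const w y)).congr_fderiv ?_
    ext u
    simp
  have h2 : HasFDerivAt (fun y => ∑ j, ∑ k, metricMat c y j k * v j * w k)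
      (∑ j, ∑ k, w k • v j • fderiv ℝ (fun y => metricMat c y j k) y) y :=
    HasFDerivAt.fun_sum fun j _ => HasFDerivAt.fun_sum fun k _ =>
      (((((contDiffOn_metricMat c j k).contDiffAt ((isOpen_chartDom c).mem_nhds
        hy)).differentiableAt (by simp)).hasFDerivAt).mul_const _).mul_const _
  have h3 : (fun y => metric c y v w) = fun y => ∑ j, ∑ k, metricMat c y j k * v j * w k :=
    funext fun y => metric_eq_sum c y v w
  rw [h3] at h1
  have h4 := congrArg (fun T => T z) (h1.unique h2)
  simp only [ContinuousLinearMap.flip_apply, sum_apply, smul_apply, smul_eq_mul,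
    fderiv_eq_sum_pd, Finset.mul_sum] at h4
  rw [h4, Finset.sum_comm]
  refine Finset.sum_congr rfl fun k _ => ?_
  rw [Finset.sum_comm]
  exact Finset.sum_congr rfl fun i _ => Finset.sum_congr rfl fun j _ => by ring

/-- The Christoffel symbols of the metric define its Levi-Civita connection. -/
theorem isLeviCivita (c : M) : IsLeviCivita (chartDom (m := m) c) (metric c) (chris c) where
  isOpen := isOpen_chartDom c
  contDiffOn_metric := contDiffOn_metric c
  contDiffOn := contDiffOn_chris c
  metric_symm y _ v w := by rw [metric_apply, metric_apply, real_inner_comm]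
  metric_pos _ hy _ hv := metric_pos c hy hv
  symm y _ v w := by
    ext l
    rw [chris_apply, chris_apply, Finset.sum_comm]
    refine Finset.sum_congr rfl fun i _ => Finset.sum_congr rfl fun j _ => ?_
    rw [christoffel_symm]
    ring
  compat y hy z v w := by
    rw [metric_apply c y v, real_inner_comm, ← metric_apply c y, metric_chris c hy,
      metric_chris c hy, fderiv_metric c hy]
    -- Exchanges the roles of `k` and `j` in one of the two Koszul sums, so that they can be added
    -- term by term.
    have h1 : ∀ F : Fin (m + 1) → Fin (m + 1) → Fin (m + 1) → ℝ,
        ∑ k, ∑ i, ∑ j, F k i j = ∑ j, ∑ i, ∑ k, F k i j := by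
      intro F
      calc _ = ∑ i, ∑ k, ∑ j, F k i j := Finset.sum_comm
        _ = ∑ i, ∑ j, ∑ k, F k i j := Finset.sum_congr rfl fun i _ => Finset.sum_comm
        _ = _ := Finset.sum_comm
    rw [h1 (fun k i j => 1 / 2 * (pd i (fun z => metricMat c z j k) y
      + pd j (fun z => metricMat c z i k) y - pd k (fun z => metricMat c z i j) y) * z i * w j
        * v k)]
    simp only [← Finset.sum_add_distrib]
    refine Finset.sum_congr rfl fun k _ => Finset.sum_congr rfl fun i _ =>
      Finset.sum_congr rfl fun j _ => ?_
    rw [show (fun z => metricMat c z k j) = fun z => metricMat c z j k from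
      funext fun z => metricMat_symm c z k j]
    ring

end Metric

end VSBM

end

noncomputable section

namespace VSBM

/-! ### Derivative of the Gram-Schmidt process along a curve tangent to the orthonormal frames -/

section GramSchmidt

variable {m : ℕ} {E : Type*} [NormedAddCommGroup E] [NormedSpace ℝ E]

theorem hasDerivAt_bilinear {G : ℝ → E →L[ℝ] E →L[ℝ] ℝ} {G' : E →L[ℝ] E →L[ℝ] ℝ} {a b : ℝ → E}
    {a' b' : E} (hG : HasDerivAt G G' 0) (ha : HasDerivAt a a' 0) (hb : HasDerivAt b b' 0) :
    HasDerivAt (fun t => G t (a t) (b t)) (G' (a 0) (b 0) + G 0 a' (b 0) + G 0 (a 0) b') 0 := by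
  have h := (hG.clm_apply ha).clm_apply hb
  simpa [add_assoc] using h

/-- Data for the orthonormalisation of a curve `A` of frames, for a moving scalar product `G`,
with values and derivatives at `0` those of a curve of orthonormal frames. -/
structure OrthoCurve (G : ℝ → E →L[ℝ] E →L[ℝ] ℝ) (G' : E →L[ℝ] E →L[ℝ] ℝ)
    (A : ℝ → Fin (m + 1) → E) (B : Fin (m + 1) → E) : Prop where
  metric : HasDerivAt G G' 0
  frame : ∀ k, HasDerivAt (fun t => A t k) (B k) 0
  ortho : ∀ k l, G 0 (A 0 k) (A 0 l) = if k = l then 1 else 0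
  tangent : ∀ k l, G' (A 0 k) (A 0 l) + G 0 (B k) (A 0 l) + G 0 (A 0 k) (B l) = 0

variable {G : ℝ → E →L[ℝ] E →L[ℝ] ℝ} {G' : E →L[ℝ] E →L[ℝ] ℝ}
  {A : ℝ → Fin (m + 1) → E} {B : Fin (m + 1) → E}

/-- By induction on `k`: if the earlier `a i` agree with `A i` to first order, the coefficient of
the projection on `a i` vanishes at `0` by orthonormality, and so does its derivative by tangency.
Thus `a k` agrees with `A k` to first order. -/
theorem OrthoCurve.gramSchmidt (h : OrthoCurve G G' A B) {a : ℝ → Fin (m + 1) → E}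
    (ha : ∀ᶠ t in 𝓝 0, ∀ k, A t k = a t k
      + ∑ i ∈ Finset.Iio k, (G t (a t i) (A t k) / G t (a t i) (a t i)) • a t i)
    (k : Fin (m + 1)) : a 0 k = A 0 k ∧ HasDerivAt (fun t => a t k) (B k) 0 := by
  induction k using WellFoundedLT.induction with
  | ind k ih =>
    have hval : ∀ i ∈ Finset.Iio k, G 0 (a 0 i) (A 0 k) / G 0 (a 0 i) (a 0 i) = 0 := by
      intro i hi
      rw [Finset.mem_Iio] at hi
      rw [(ih i hi).1, h.ortho i k, if_neg hi.ne, zero_div]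
    have hder : ∀ i ∈ Finset.Iio k, HasDerivAt
        (fun t => (G t (a t i) (A t k) / G t (a t i) (a t i)) • a t i) 0 0 := by
      intro i hi
      have hv := hval i hi
      rw [Finset.mem_Iio] at hi
      obtain ⟨h0, h1⟩ := ih i hi
      have hn := hasDerivAt_bilinear h.metric h1 (h.frame k)
      have hd := hasDerivAt_bilinear h.metric h1 h1
      rw [h0, h.tangent i k] at hn
      rw [h0, h.tangent i i] at hd
      have hq := hn.fun_div hd (by rw [h0, h.ortho i i, if_pos rfl]; exact one_ne_zero)
      have hs := hq.fun_smul h1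
      rw [hv] at hs
      simpa using hs
    have hsum := HasDerivAt.fun_sum hder
    rw [Finset.sum_const_zero] at hsum
    have hak : (fun t => a t k) =ᶠ[𝓝 0] fun t => A t k
        - ∑ i ∈ Finset.Iio k, (G t (a t i) (A t k) / G t (a t i) (a t i)) • a t i := by
      filter_upwards [ha] with t ht
      exact eq_sub_of_add_eq (ht k).symm
    refine ⟨?_, ?_⟩
    · refine hak.self_of_nhds.trans ?_
      beta_reduce
      rw [Finset.sum_eq_zero, sub_zero]
      intro i hi
      rw [hval i hi, zero_smul]
    · have h2 := (h.frame k).fun_sub hsum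
      rw [sub_zero] at h2
      exact h2.congr_of_eventuallyEq hak

/-- Tangency with `k = l` makes the squared length stationary at the value `1`, so normalising
changes nothing to first order. The nonvanishing excludes the degenerate case of
`gramSchmidtOrthonormalBasis`. -/
theorem OrthoCurve.gramSchmidtNormed (h : OrthoCurve G G' A B) {a : ℝ → Fin (m + 1) → E}
    (ha : ∀ᶠ t in 𝓝 0, ∀ k, A t k = a t k
      + ∑ i ∈ Finset.Iio k, (G t (a t i) (A t k) / G t (a t i) (a t i)) • a t i)
    (k : Fin (m + 1)) :
    (∀ᶠ t in 𝓝 0, a t k ≠ 0) ∧ (√(G 0 (a 0 k) (a 0 k)))⁻¹ • a 0 k = A 0 k ∧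
      HasDerivAt (fun t => (√(G t (a t k) (a t k)))⁻¹ • a t k) (B k) 0 := by
  obtain ⟨h0, h1⟩ := h.gramSchmidt ha k
  have hone : G 0 (a 0 k) (a 0 k) = 1 := by rw [h0, h.ortho k k, if_pos rfl]
  refine ⟨h1.continuousAt.eventually_ne (fun h2 => ?_), ?_, ?_⟩
  · rw [h2] at hone
    simp at hone
  · rw [hone, h0]
    simp
  · have hd := hasDerivAt_bilinear h.metric h1 h1
    rw [h0, h.tangent k k] at hd
    have hs := hd.sqrt (by rw [hone]; exact one_ne_zero)
    have hi := hs.fun_inv (by rw [hone]; simp)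
    have hf := hi.fun_smul h1
    rw [hone] at hf
    simpa using hf

theorem gramSchmidtOrthonormalBasis_eq {ι G : Type*} [NormedAddCommGroup G]
    [InnerProductSpace ℝ G] [LinearOrder ι] [LocallyFiniteOrderBot ι] [WellFoundedLT ι] [Fintype ι]
    [FiniteDimensional ℝ G] (hd : Module.finrank ℝ G = Fintype.card ι) (f : ι → G) (k : ι)
    (h : InnerProductSpace.gramSchmidt ℝ f k ≠ 0) :
    InnerProductSpace.gramSchmidtOrthonormalBasis hd f k
      = ‖InnerProductSpace.gramSchmidt ℝ f k‖⁻¹ • InnerProductSpace.gramSchmidt ℝ f k :=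
  InnerProductSpace.gramSchmidtOrthonormalBasis_apply hd
    (smul_ne_zero (inv_ne_zero (norm_ne_zero_iff.2 h)) h)

end GramSchmidt

/-! ### Frames in a chart -/

section FrameCoordinates

variable {m : ℕ} {M : Type*} [TopologicalSpace M] [ChartedSpace (Mod m) M]
  [RiemannianBundle (fun x : M => TangentSpace (𝓡 (m + 1)) x)]

/-- Coordinates of the frame `u` in the chart around `c`. -/
def chartFrame (c : M) (u : OFrame m M) : FrameSpace m (Mod m) :=
  (extChartAt (𝓡 (m + 1)) c u.pt, fun k => coords c u.pt (u.e k))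

theorem chartFrame_self (u : OFrame m M) :
    chartFrame u.pt u = (extChartAt (𝓡 (m + 1)) u.pt u.pt, frameCoords u) := rfl

theorem frameOf_e (c : M) (y : Mod m) (A : Fin (m + 1) → Mod m) (k : Fin (m + 1))
    (h : InnerProductSpace.gramSchmidt ℝ (fun k => vecOf c (ptOf c y) (A k)) k ≠ 0) :
    (frameOf c y A).e k
      = ‖InnerProductSpace.gramSchmidt ℝ (fun k => vecOf c (ptOf c y) (A k)) k‖⁻¹ •
        InnerProductSpace.gramSchmidt ℝ (fun k => vecOf c (ptOf c y) (A k)) k :=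
  gramSchmidtOrthonormalBasis_eq (G := TangentSpace (𝓡 (m + 1)) (ptOf c y))
    (finrank_tangent (ptOf c y)) (fun k => vecOf c (ptOf c y) (A k)) k h

variable [IsManifold (𝓡 (m + 1)) ∞ M]

theorem chartFrame_change {c' c : M} {u : OFrame m M}
    (hc' : u.pt ∈ (extChartAt (𝓡 (m + 1)) c').source)
    (hc : u.pt ∈ (extChartAt (𝓡 (m + 1)) c).source) :
    chartFrame c u = (transMap c' c (chartFrame c' u).1,
      fun k => fderiv ℝ (transMap c' c) (chartFrame c' u).1 ((chartFrame c' u).2 k)) := by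
  refine Prod.ext ?_ (funext fun k => ?_)
  · simp only [chartFrame, transMap, ptOf_ext hc']
  · simp only [chartFrame]
    exact coords_change hc' hc _

theorem metric_chartFrame {c : M} {u : OFrame m M}
    (hc : u.pt ∈ (extChartAt (𝓡 (m + 1)) c).source) (k l : Fin (m + 1)) :
    metric c (chartFrame c u).1 ((chartFrame c u).2 k) ((chartFrame c u).2 l)
      = if k = l then 1 else 0 := by
  simp only [chartFrame]
  rw [metric_coords hc, orthonormal_iff_ite.1 u.e.orthonormal]

theorem metric_change {c' c : M} {y : Mod m} (hy : y ∈ chartDom c')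
    (hc : ptOf c' y ∈ (extChartAt (𝓡 (m + 1)) c).source) (v w : Mod m) :
    metric c' y v w = metric c (transMap c' c y) (fderiv ℝ (transMap c' c) y v)
      (fderiv ℝ (transMap c' c) y w) := by
  have h : ∀ v, fderiv ℝ (transMap c' c) y v
      = coords c (ptOf c' y) (vecOf c' (ptOf c' y) v) := by
    intro v
    rw [coords_trans hy hc, coords_vecOf (ptOf_mem hy)]
  rw [h, h, transMap, metric_coords hc, metric_apply]

section Derivative

variable {c' c : M} {y : ℝ → Mod m} {w : Mod m} {A : ℝ → Fin (m + 1) → Mod m}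
  {B : Fin (m + 1) → Mod m}

/-- The velocity of the orthonormalisation of a curve of frames tangent to `OM`, in the chart
around `c'`. -/
theorem hasDerivAt_frameOf_self (hy : y 0 ∈ chartDom c') (hyw : HasDerivAt y w 0)
    (h : OrthoCurve (fun t => metric c' (y t)) (fderiv ℝ (metric c') (y 0) w) A B) :
    (fun k => coords c' (ptOf c' (y 0)) ((frameOf c' (y 0) (A 0)).e k)) = A 0 ∧
      HasDerivAt (fun t k => coords c' (ptOf c' (y t)) ((frameOf c' (y t) (A t)).e k)) B 0 := by
  have hdom : ∀ᶠ t in 𝓝 0, y t ∈ chartDom c' :=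
    hyw.continuousAt.eventually_mem ((isOpen_chartDom c').mem_nhds hy)
  set gs : ∀ t k, TangentSpace (𝓡 (m + 1)) (ptOf c' (y t)) := fun t =>
    InnerProductSpace.gramSchmidt ℝ fun k => vecOf c' (ptOf c' (y t)) (A t k) with hgs
  set a : ℝ → Fin (m + 1) → Mod m := fun t k => coords c' (ptOf c' (y t)) (gs t k) with ha
  have hin : ∀ t, y t ∈ chartDom c' → ∀ X Y : TangentSpace (𝓡 (m + 1)) (ptOf c' (y t)),
      metric c' (y t) (coords c' _ X) (coords c' _ Y) = ⟪X, Y⟫_ℝ := by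
    intro t ht X Y
    have := metric_coords (ptOf_mem ht) X Y
    rwa [ext_ptOf ht] at this
  have hrec : ∀ᶠ t in 𝓝 0, ∀ k, A t k = a t k + ∑ i ∈ Finset.Iio k,
      (metric c' (y t) (a t i) (A t k) / metric c' (y t) (a t i) (a t i)) • a t i := by
    filter_upwards [hdom] with t ht k
    have h1 := InnerProductSpace.gramSchmidt_def'' ℝ
      (fun k => vecOf c' (ptOf c' (y t)) (A t k)) k
    have h2 := congrArg (coordsL c' (ptOf c' (y t))) h1
    have h3 : ∀ k, coords c' (ptOf c' (y t)) (vecOf c' (ptOf c' (y t)) (A t k)) = A t k :=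
      fun k => coords_vecOf (ptOf_mem ht) _
    simp only [map_add, map_sum, map_smul, coordsL_apply, h3] at h2
    refine h2.trans ?_
    congr 1
    refine Finset.sum_congr rfl fun i _ => ?_
    have h4 := hin t ht (gs t i) (vecOf c' (ptOf c' (y t)) (A t k))
    rw [h3] at h4
    have h5 := hin t ht (gs t i) (gs t i)
    rw [real_inner_self_eq_norm_sq] at h5
    change _ = (metric c' (y t) (coords c' _ (gs t i)) (A t k)
      / metric c' (y t) (coords c' _ (gs t i)) (coords c' _ (gs t i))) • _
    rw [h4, h5]
    rfl
  have hframe : ∀ k, ∀ᶠ t in 𝓝 0,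
      coords c' (ptOf c' (y t)) ((frameOf c' (y t) (A t)).e k)
        = (√(metric c' (y t) (a t k) (a t k)))⁻¹ • a t k := by
    intro k
    filter_upwards [hdom, (h.gramSchmidtNormed hrec k).1] with t ht hne
    have hne' : gs t k ≠ 0 := by
      intro h0
      apply hne
      change coordsL c' _ (gs t k) = 0
      rw [h0, map_zero]
    have h5 := hin t ht (gs t k) (gs t k)
    rw [real_inner_self_eq_norm_sq] at h5
    have h6 : (frameOf c' (y t) (A t)).e k = (‖gs t k‖)⁻¹ • gs t k :=
      frameOf_e c' (y t) (A t) k hne'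
    rw [h6]
    refine (coords_smul c' _ _ _).trans ?_
    change _ = (√(metric c' (y t) (coords c' _ (gs t k)) (coords c' _ (gs t k))))⁻¹ • _
    rw [h5, Real.sqrt_sq (norm_nonneg _)]
  refine ⟨funext fun k => ?_, hasDerivAt_pi.2 fun k => ?_⟩
  · rw [(hframe k).self_of_nhds]
    exact (h.gramSchmidtNormed hrec k).2.1
  · exact (h.gramSchmidtNormed hrec k).2.2.congr_of_eventuallyEq (hframe k)

/-- The velocity of the orthonormalisation of a curve of frames tangent to `OM`, in another
chart. -/
theorem hasDerivAt_chartFrame_frameOf (hy : y 0 ∈ chartDom c')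
    (hc : ptOf c' (y 0) ∈ (extChartAt (𝓡 (m + 1)) c).source) (hyw : HasDerivAt y w 0)
    (h : OrthoCurve (fun t => metric c' (y t)) (fderiv ℝ (metric c') (y 0) w) A B) :
    chartFrame c (frameOf c' (y 0) (A 0))
        = (transMap c' c (y 0), fun k => fderiv ℝ (transMap c' c) (y 0) (A 0 k)) ∧
      HasDerivAt (fun t => chartFrame c (frameOf c' (y t) (A t)))
        (fderiv ℝ (transMap c' c) (y 0) w,
          fun k => fderiv ℝ (fderiv ℝ (transMap c' c)) (y 0) w (A 0 k)
            + fderiv ℝ (transMap c' c) (y 0) (B k)) 0 := by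
  obtain ⟨h0, h1⟩ := hasDerivAt_frameOf_self hy hyw h
  have hdom : ∀ᶠ t in 𝓝 0, y t ∈ chartDom c' ∧
      ptOf c' (y t) ∈ (extChartAt (𝓡 (m + 1)) c).source :=
    hyw.continuousAt.eventually (eventually_transDom hy hc)
  have heq : (fun t => chartFrame c (frameOf c' (y t) (A t))) =ᶠ[𝓝 0] fun t =>
      (transMap c' c (y t), fun k => fderiv ℝ (transMap c' c) (y t)
        (coords c' (ptOf c' (y t)) ((frameOf c' (y t) (A t)).e k))) := by
    filter_upwards [hdom] with t ht
    refine Prod.ext rfl (funext fun k => ?_)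
    exact coords_trans ht.1 ht.2 _
  have hτ := contDiffAt_transMap hy hc
  have hτ1 : HasDerivAt (fun t => transMap c' c (y t)) (fderiv ℝ (transMap c' c) (y 0) w) 0 :=
    (hτ.differentiableAt (by simp)).hasFDerivAt.comp_hasDerivAt 0 hyw
  have hτ2 : HasDerivAt (fun t => fderiv ℝ (transMap c' c) (y t))
      (fderiv ℝ (fderiv ℝ (transMap c' c)) (y 0) w) 0 :=
    ((hτ.fderiv_right (m := ∞) (by simp)).differentiableAt
      (by simp)).hasFDerivAt.comp_hasDerivAt 0 hyw
  refine ⟨heq.self_of_nhds.trans ?_, ?_⟩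
  · exact Prod.ext rfl (funext fun k => congrArg (fderiv ℝ (transMap c' c) (y 0)) (congrFun h0 k))
  · refine HasDerivAt.congr_of_eventuallyEq ?_ heq
    refine hτ1.prodMk (hasDerivAt_pi.2 fun k => ?_)
    have h2 := hτ2.clm_apply (hasDerivAt_pi.1 h1 k)
    rw [congrFun h0 k] at h2
    exact h2

end Derivative

end FrameCoordinates

end VSBM

end

noncomputable section

namespace VSBM

/-! ### Functions on the frame bundle read in a chart -/

section Represents

variable {m : ℕ} {M : Type*} [TopologicalSpace M] [ChartedSpace (Mod m) M]
  [RiemannianBundle (fun x : M => TangentSpace (𝓡 (m + 1)) x)]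

/-- On the frames with coordinates in `N`, the function `F` is given by `φ` in the chart
around `c`. -/
def Represents (c : M) (N : Set (FrameSpace m (Mod m))) (F : OFrame m M → ℝ)
    (φ : FrameSpace m (Mod m) → ℝ) : Prop :=
  ∀ u : OFrame m M, u.pt ∈ (extChartAt (𝓡 (m + 1)) c).source → chartFrame c u ∈ N →
    F u = φ (chartFrame c u)

/-- The vertical field is an infinitesimal rotation, hence skew for the scalar product in which the
frame is orthonormal. -/
theorem vertField_tangent {E : Type*} [NormedAddCommGroup E] [NormedSpace ℝ E]
    {G : E →L[ℝ] E →L[ℝ] ℝ} {z : FrameSpace m E}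
    (hz : ∀ k l, G (z.2 k) (z.2 l) = if k = l then 1 else 0) (a k l : Fin (m + 1)) :
    G ((vertField a z).2 k) (z.2 l) + G (z.2 k) ((vertField a z).2 l) = 0 := by
  rw [vertField_snd, vertField_snd]
  have h1 : ∀ (p : Prop) [Decidable p] (v w : E), G (if p then v else 0) w
      = if p then G v w else 0 := by
    intro p _ v w; split_ifs <;> simp
  have h2 : ∀ (p : Prop) [Decidable p] (v w : E), G w (if p then v else 0)
      = if p then G w v else 0 := by
    intro p _ v w; split_ifs <;> simp
  simp only [map_sub, sub_apply, h1, h2, hz]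
  by_cases hk : k = 0 <;> by_cases hl : l = 0 <;> by_cases hka : k = a <;> by_cases hla : l = a <;>
    simp_all [eq_comm]

theorem tangentVert_eq (u : OFrame m M) (i : Fin m) :
    (fun k => if k = 0 then frameCoords u i.succ else if k = i.succ then -frameCoords u 0 else 0)
      = (vertField i.succ (chartFrame u.pt u)).2 := by
  funext k
  rw [vertField_snd]
  by_cases hk : k = 0
  · subst hk
    simp [(Fin.succ_ne_zero i).symm, chartFrame_self]
  · simp only [hk, if_false, zero_sub]
    split_ifs
    · rfl
    · simp

theorem tangentHor_eq (u : OFrame m M) (i : Fin (m + 1)) :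
    (fun k => WithLp.toLp 2 fun l =>
      -∑ p, ∑ q, christoffel u.pt l p q (extChartAt (𝓡 (m + 1)) u.pt u.pt)
        * frameCoords u k p * frameCoords u i q)
      = (horField (chris u.pt) i (chartFrame u.pt u)).2 := by
  funext k
  ext l
  simp only [horField, horLift, chartFrame_self]
  rw [PiLp.neg_apply, chris_apply]

variable [IsManifold (𝓡 (m + 1)) ∞ M]
  [IsContMDiffRiemannianBundle (𝓡 (m + 1)) ∞ (Mod m)
      (fun x : M => TangentSpace (𝓡 (m + 1)) x)]
  {c : M} {N : Set (FrameSpace m (Mod m))} {F : OFrame m M → ℝ} {φ : FrameSpace m (Mod m) → ℝ}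
  {u : OFrame m M}

/-- Transfers a derivative defined in the chart around `u.pt` to the fixed chart around `c`. As `u`
varies, `c` and `φ` stay the same, so derivatives can be iterated. -/
theorem dirDeriv_eq (hF : Represents c N F φ) (hN : IsOpen N)
    (hu : u.pt ∈ (extChartAt (𝓡 (m + 1)) c).source) (huN : chartFrame c u ∈ N)
    (hφ : DifferentiableAt ℝ φ (chartFrame c u)) (w : Mod m) (B : Fin (m + 1) → Mod m)
    (htan : ∀ k l, fderiv ℝ (metric u.pt) (chartFrame u.pt u).1 w ((chartFrame u.pt u).2 k)
        ((chartFrame u.pt u).2 l)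
      + metric u.pt (chartFrame u.pt u).1 (B k) ((chartFrame u.pt u).2 l)
      + metric u.pt (chartFrame u.pt u).1 ((chartFrame u.pt u).2 k) (B l) = 0) :
    dirDeriv F u w B = fderiv ℝ φ (chartFrame c u)
      (fderiv ℝ (transMap u.pt c) (chartFrame u.pt u).1 w,
        fun k => fderiv ℝ (fderiv ℝ (transMap u.pt c)) (chartFrame u.pt u).1 w
            ((chartFrame u.pt u).2 k)
          + fderiv ℝ (transMap u.pt c) (chartFrame u.pt u).1 (B k)) := by
  have hself : u.pt ∈ (extChartAt (𝓡 (m + 1)) u.pt).source := mem_extChartAt_source u.pt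
  set z := chartFrame u.pt u with hz
  set y : ℝ → Mod m := fun t => z.1 + t • w with hydef
  set A : ℝ → Fin (m + 1) → Mod m := fun t => z.2 + t • B with hAdef
  have hy0 : y 0 = z.1 := by simp [hydef]
  have hA0 : A 0 = z.2 := by simp [hAdef]
  have hzdom : z.1 ∈ chartDom u.pt := ext_mem hself
  have hpt : ptOf u.pt z.1 = u.pt := ptOf_ext hself
  have hyw : HasDerivAt y w 0 := by
    have h := ((hasDerivAt_id (0 : ℝ)).smul_const w).const_add z.1
    rw [one_smul] at h
    exact h
  have hAB : HasDerivAt A B 0 := by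
    have h := ((hasDerivAt_id (0 : ℝ)).smul_const B).const_add z.2
    rw [one_smul] at h
    exact h
  have hcurve : OrthoCurve (fun t => metric u.pt (y t)) (fderiv ℝ (metric u.pt) (y 0) w) A B := by
    refine ⟨?_, hasDerivAt_pi.1 hAB, ?_, ?_⟩
    · exact HasFDerivAt.comp_hasDerivAt 0
        ((isLeviCivita u.pt).hasFDerivAt_metric (by rwa [hy0])) hyw
    · intro k l
      rw [hy0, hA0]
      exact metric_chartFrame hself k l
    · intro k l
      rw [hy0, hA0]
      exact htan k l
  obtain ⟨h0, h1⟩ := hasDerivAt_chartFrame_frameOf (c := c) (by rwa [hy0])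
    (by rwa [hy0, hpt]) hyw hcurve
  rw [hy0, hA0] at h0 h1
  have hval : chartFrame c (frameOf u.pt (y 0) (A 0)) = chartFrame c u := by
    rw [hy0, hA0, h0, chartFrame_change hself hu]
  have hev : (fun t : ℝ => F (frameOf u.pt (y t) (A t))) =ᶠ[𝓝 0]
      fun t => φ (chartFrame c (frameOf u.pt (y t) (A t))) := by
    have e1 : ∀ᶠ t in 𝓝 0, y t ∈ chartDom u.pt ∧
        ptOf u.pt (y t) ∈ (extChartAt (𝓡 (m + 1)) c).source :=
      hyw.continuousAt.eventually (eventually_transDom (by rwa [hy0]) (by rwa [hy0, hpt]))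
    have e2 : ∀ᶠ t in 𝓝 0, chartFrame c (frameOf u.pt (y t) (A t)) ∈ N :=
      h1.continuousAt.eventually_mem (hN.mem_nhds (by rwa [hval]))
    filter_upwards [e1, e2] with t ht1 ht2
    exact hF _ ht1.2 ht2
  have hd := (HasFDerivAt.comp_hasDerivAt (l := φ) (0 : ℝ)
    (by rw [hval]; exact hφ.hasFDerivAt) h1).congr_of_eventuallyEq hev
  exact hd.deriv

/-- Vertical fields only recombine frame vectors, which commutes with the linear action of a change
of chart. -/
theorem V_eq (hF : Represents c N F φ) (hN : IsOpen N)
    (hu : u.pt ∈ (extChartAt (𝓡 (m + 1)) c).source) (huN : chartFrame c u ∈ N)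
    (hφ : DifferentiableAt ℝ φ (chartFrame c u)) (i : Fin m) :
    V i F u = fderiv ℝ φ (chartFrame c u) (vertField i.succ (chartFrame c u)) := by
  have hself : u.pt ∈ (extChartAt (𝓡 (m + 1)) u.pt).source := mem_extChartAt_source u.pt
  rw [V, tangentVert_eq, dirDeriv_eq hF hN hu huN hφ]
  · congr 1
    rw [chartFrame_change hself hu]
    refine Prod.ext ?_ (funext fun k => ?_)
    · simp
    · simp only [map_zero, zero_apply, zero_add, vertField_snd, map_sub]
      congr 1 <;> split_ifs <;> simp
  · intro k l
    rw [map_zero, zero_apply, zero_apply, zero_add]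
    exact vertField_tangent (metric_chartFrame hself) _ k l

/-- The second derivative of the change of chart, coming from the velocity of the frame, cancels
against the inhomogeneous term in the transformation law of the Christoffel symbols. -/
theorem H_eq (hF : Represents c N F φ) (hN : IsOpen N)
    (hu : u.pt ∈ (extChartAt (𝓡 (m + 1)) c).source) (huN : chartFrame c u ∈ N)
    (hφ : DifferentiableAt ℝ φ (chartFrame c u)) (i : Fin (m + 1)) :
    H i F u = fderiv ℝ φ (chartFrame c u) (horField (chris c) i (chartFrame c u)) := by
  have hself : u.pt ∈ (extChartAt (𝓡 (m + 1)) u.pt).source := mem_extChartAt_source u.pt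
  have hdom : (chartFrame u.pt u).1 ∈ chartDom u.pt := ext_mem hself
  have hpt : ptOf u.pt (chartFrame u.pt u).1 = u.pt := ptOf_ext hself
  have hsrc : ptOf u.pt (chartFrame u.pt u).1 ∈ (extChartAt (𝓡 (m + 1)) c).source := by
    rwa [hpt]
  rw [H, tangentHor_eq, dirDeriv_eq hF hN hu huN hφ]
  · congr 1
    rw [chartFrame_change hself hu]
    have htr := (isLeviCivita c).transform (isLeviCivita u.pt) (τ := transMap u.pt c) hdom
      (ext_mem hsrc) (contDiffAt_transMap hdom hsrc) (surjective_fderiv_transMap hdom hsrc)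
      (by
        filter_upwards [eventually_transDom hdom hsrc] with x hx v w
        exact metric_change hx.1 hx.2 v w)
    have hs : IsSymmSndFDerivAt ℝ (transMap u.pt c) (chartFrame u.pt u).1 :=
      (contDiffAt_transMap hdom hsrc).isSymmSndFDerivAt (by simpa using ENat.LEInfty.out)
    refine Prod.ext rfl (funext fun k => ?_)
    simp only [horField, horLift, map_neg, htr]
    rw [hs.eq (frameCoords u i)]
    change _ = - chris c _ _ _
    simp only [chartFrame_self]
    abel
  · intro k l
    exact (isLeviCivita u.pt).horLift_tangent (z := chartFrame u.pt u) hdom (frameCoords u i) k l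

end Represents

end VSBM

end

noncomputable section

namespace VSBM

/-! ### Rotations of the frames fixing the first vector -/

section Rotation

variable {m : ℕ}

/-- Orthogonal matrices fixing the first basis vector. -/
structure IsFrameRot (Q : Fin (m + 1) → Fin (m + 1) → ℝ) : Prop where
  row_zero : ∀ l, Q 0 l = if l = 0 then 1 else 0
  col_zero : ∀ k, Q k 0 = if k = 0 then 1 else 0
  row : ∀ k l, ∑ p, Q k p * Q l p = if k = l then 1 else 0
  col : ∀ k l, ∑ p, Q p k * Q p l = if k = l then 1 else 0

/-- The trace of `Q T Qᵀ` is that of `T`, and the `(0, 0)` entry is unchanged because `Q` fixes the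
first index; hence the trace over the other indices is invariant as well. -/
theorem IsFrameRot.sum_succ {Q : Fin (m + 1) → Fin (m + 1) → ℝ} (hQ : IsFrameRot Q)
    {T T' : Fin (m + 1) → Fin (m + 1) → ℝ}
    (h : ∀ a b, T' a b = ∑ k, ∑ l, Q a k * Q b l * T k l) :
    ∑ i : Fin m, T' i.succ i.succ = ∑ i : Fin m, T i.succ i.succ := by
  have h0 : T' 0 0 = T 0 0 := by simp [h, hQ.row_zero]
  have h1 : ∑ a, T' a a = ∑ a, T a a := by
    simp only [h]
    rw [Finset.sum_comm]
    refine Finset.sum_congr rfl fun k _ => ?_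
    rw [Finset.sum_comm]
    simp only [← Finset.sum_mul, hQ.col]
    simp
  rw [Fin.sum_univ_succ, Fin.sum_univ_succ, h0] at h1
  exact add_left_cancel h1

/-- The frames whose base point and first vector are in `D`. -/
def frameSet {E : Type*} (m : ℕ) (D : Set (E × E)) : Set (FrameSpace m E) := {z | (z.1, z.2 0) ∈ D}

theorem isOpen_frameSet {E : Type*} [TopologicalSpace E] {D : Set (E × E)}
    (hD : IsOpen D) : IsOpen (frameSet m D) :=
  hD.preimage (continuous_fst.prodMk ((continuous_apply 0).comp continuous_snd))

variable {E : Type*} [NormedAddCommGroup E] [NormedSpace ℝ E]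

/-- The action of a matrix on frames. -/
def frameRot (Q : Fin (m + 1) → Fin (m + 1) → ℝ) : FrameSpace m E →L[ℝ] FrameSpace m E :=
  (ContinuousLinearMap.fst ℝ E (Fin (m + 1) → E)).prod
    (ContinuousLinearMap.pi fun k => ∑ l, Q k l • frameProj l)

@[simp]
theorem frameRot_fst (Q : Fin (m + 1) → Fin (m + 1) → ℝ) (z : FrameSpace m E) :
    (frameRot Q z).1 = z.1 := rfl

@[simp]
theorem frameRot_snd (Q : Fin (m + 1) → Fin (m + 1) → ℝ) (z : FrameSpace m E) (k : Fin (m + 1)) :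
    (frameRot Q z).2 k = ∑ l, Q k l • z.2 l := by
  change (∑ l, Q k l • frameProj l : FrameSpace m E →L[ℝ] E) z = _
  simp [sum_apply]

theorem frameRot_snd_zero {Q : Fin (m + 1) → Fin (m + 1) → ℝ} (hQ : IsFrameRot Q)
    (z : FrameSpace m E) : (frameRot Q z).2 0 = z.2 0 := by
  simp [hQ.row_zero]

theorem vertField_frameRot {Q : Fin (m + 1) → Fin (m + 1) → ℝ} (hQ : IsFrameRot Q)
    (a : Fin (m + 1)) (z : FrameSpace m E) :
    vertField a (frameRot Q z) = frameRot Q (∑ l, Q a l • vertField l z) := by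
  have h1 : (∑ l, Q a l • vertField l z).1 = 0 := by
    simp [Prod.fst_sum]
  have h2 : ∀ k, (∑ l, Q a l • vertField l z).2 k
      = (if k = 0 then ∑ l, Q a l • z.2 l else 0) - Q a k • z.2 0 := by
    intro k
    simp only [Prod.snd_sum, Finset.sum_apply, Prod.smul_snd, Pi.smul_apply, vertField_snd,
      smul_sub, Finset.sum_sub_distrib, smul_ite, smul_zero, Finset.sum_ite_eq, Finset.mem_univ,
      if_true]
    split_ifs <;> simp
  refine Prod.ext ?_ (funext fun k => ?_)
  · rw [frameRot_fst, h1, vertField_fst]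
  · rw [frameRot_snd, vertField_snd, frameRot_snd_zero hQ, frameRot_snd]
    simp only [h2, smul_sub, smul_ite, smul_zero, Finset.sum_sub_distrib, Finset.sum_ite_eq',
      Finset.mem_univ, if_true, hQ.col_zero, smul_smul, ← Finset.sum_smul, hQ.row]
    split_ifs <;> simp

/-- The lift acts linearly on each frame vector, so any matrix works here; for the vertical fields
`Q` must be orthogonal and fix `e^0`. -/
theorem horField_frameRot (Γ : E → E →L[ℝ] E →L[ℝ] E) (Q : Fin (m + 1) → Fin (m + 1) → ℝ)
    (a : Fin (m + 1)) (z : FrameSpace m E) :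
    horField Γ a (frameRot Q z) = frameRot Q (∑ l, Q a l • horField Γ l z) := by
  refine Prod.ext ?_ (funext fun k => ?_)
  · simp [horField, horLift, Prod.fst_sum]
  · rw [frameRot_snd]
    simp only [Prod.snd_sum, Finset.sum_apply, Prod.smul_snd, Pi.smul_apply, horField, horLift,
      frameRot_fst, frameRot_snd, map_sum, map_smul, sum_apply, smul_apply, Finset.smul_sum,
      smul_neg, Finset.sum_neg_distrib]
    rw [Finset.sum_comm]
    simp only [smul_comm (Q k _)]

theorem frameRot_mem {Q : Fin (m + 1) → Fin (m + 1) → ℝ} (hQ : IsFrameRot Q) {D : Set (E × E)}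
    {z : FrameSpace m E} : frameRot Q z ∈ frameSet m D ↔ z ∈ frameSet m D := by
  change ((frameRot Q z).1, (frameRot Q z).2 0) ∈ D ↔ (z.1, z.2 0) ∈ D
  rw [frameRot_snd_zero hQ, frameRot_fst]

/-- The function `φ ∘ frameRot Q`. -/
def pullRot {Q : Fin (m + 1) → Fin (m + 1) → ℝ} (hQ : IsFrameRot Q) {D : Set (E × E)}
    (φ : smoothOn (frameSet m D)) : smoothOn (frameSet m D) :=
  ⟨fun z => φ.1 (frameRot Q z), ContDiffOn.comp φ.2 (ContDiff.contDiffOn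
    (ContinuousLinearMap.contDiff (frameRot (E := E) Q))) fun _ hz => (frameRot_mem hQ).2 hz⟩

variable {D : Set (E × E)} (hD : IsOpen D) {Q : Fin (m + 1) → Fin (m + 1) → ℝ} (hQ : IsFrameRot Q)

/-- A family of fields which is rotated by `Q` gives derivations which are rotated by `Q`. -/
theorem pullRot_lieDer {X : Fin (m + 1) → FrameSpace m E → FrameSpace m E}
    (hX : ∀ a, ContDiffOn ℝ ∞ (X a) (frameSet m D)) (a : Fin (m + 1))
    (h : ∀ z, X a (frameRot Q z) = frameRot Q (∑ l, Q a l • X l z))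
    (φ : smoothOn (frameSet m D)) :
    pullRot hQ (lieDer (isOpen_frameSet hD) (X a) (hX a) φ)
      = ∑ l, Q a l • lieDer (isOpen_frameSet hD) (X l) (hX l) (pullRot hQ φ) := by
  ext z
  have hsum : ∀ ψ : Fin (m + 1) → smoothOn (frameSet m D),
      (∑ l, Q a l • ψ l : smoothOn (frameSet m D)).1 z = ∑ l, Q a l * (ψ l).1 z := by
    intro ψ
    rw [AddSubmonoidClass.coe_finsetSum, Finset.sum_apply]
    rfl
  rw [hsum]
  by_cases hz : z ∈ frameSet m D
  · have hz' := (frameRot_mem hQ).2 hz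
    have h1 : ∀ v, fderiv ℝ (pullRot hQ φ).1 z v
        = fderiv ℝ φ.1 (frameRot Q z) (frameRot Q v) := by
      intro v
      have h2 := HasFDerivAt.comp (f := frameRot (E := E) Q) (g := φ.1) z
        (smoothOn.differentiableAt (isOpen_frameSet hD) φ hz').hasFDerivAt
        (ContinuousLinearMap.hasFDerivAt (frameRot (E := E) Q))
      exact congrArg (fun T => T v) h2.fderiv
    simp only [lieDer_apply _ _ _ hz, h1]
    change (lieDer (isOpen_frameSet hD) (X a) (hX a) φ).1 (frameRot Q z) = _
    rw [lieDer_apply _ _ _ hz', h]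
    simp only [map_sum, map_smul, smul_eq_mul]
  · have hz' := fun h => hz ((frameRot_mem hQ).1 h)
    simp only [lieDer_apply_of_notMem _ _ _ hz, mul_zero, Finset.sum_const_zero]
    exact lieDer_apply_of_notMem (isOpen_frameSet hD) (hX a) _ hz'

end Rotation

/-! ### Rotation of the frames over a point of the unit tangent bundle -/

section FrameRotation

variable {m : ℕ} {M : Type*} [TopologicalSpace M] [ChartedSpace (Mod m) M]
  [RiemannianBundle (fun x : M => TangentSpace (𝓡 (m + 1)) x)]

theorem exists_orthonormalBasis_rot {G : Type*} [NormedAddCommGroup G] [InnerProductSpace ℝ G]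
    [FiniteDimensional ℝ G] (e : OrthonormalBasis (Fin (m + 1)) ℝ G)
    {Q : Fin (m + 1) → Fin (m + 1) → ℝ} (hQ : IsFrameRot Q) :
    ∃ e' : OrthonormalBasis (Fin (m + 1)) ℝ G, ∀ k, e' k = ∑ l, Q k l • e l := by
  have ho : Orthonormal ℝ (fun k => ∑ l, Q k l • e l) := by
    rw [orthonormal_iff_ite]
    intro k l
    rw [← hQ.row k l]
    simp only [sum_inner, inner_sum, real_inner_smul_left, real_inner_smul_right,
      orthonormal_iff_ite.1 e.orthonormal]
    simp [mul_comm]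
  have ho' : Orthonormal ℝ
      (Set.domRestrict (Set.univ : Set (Fin (m + 1))) (fun k => ∑ l, Q k l • e l)) :=
    ho.comp _ Subtype.val_injective
  obtain ⟨b, hb⟩ := ho'.exists_orthonormalBasis_extension_of_card_eq
    (Module.finrank_eq_card_basis e.toBasis)
  exact ⟨b, fun k => hb k (Set.mem_univ k)⟩

theorem isFrameRot_inner {G : Type*} [NormedAddCommGroup G] [InnerProductSpace ℝ G]
    (e e' : OrthonormalBasis (Fin (m + 1)) ℝ G) (h : e' 0 = e 0) :
    IsFrameRot fun k l => ⟪e l, e' k⟫_ℝ where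
  row_zero l := by
    rw [h, orthonormal_iff_ite.1 e.orthonormal]
  col_zero k := by
    rw [← h, orthonormal_iff_ite.1 e'.orthonormal]
    simp only [eq_comm]
  row k l := by
    rw [← orthonormal_iff_ite.1 e'.orthonormal, ← e.sum_inner_mul_inner (e' k) (e' l)]
    exact Finset.sum_congr rfl fun p _ => by rw [real_inner_comm (e' k)]
  col k l := by
    rw [← orthonormal_iff_ite.1 e.orthonormal, ← e'.sum_inner_mul_inner (e k) (e l)]
    exact Finset.sum_congr rfl fun p _ => by rw [real_inner_comm (e l)]

theorem chartFrame_of_rot {x : M} (c : M)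
    (e e' : OrthonormalBasis (Fin (m + 1)) ℝ (TangentSpace (𝓡 (m + 1)) x))
    {Q : Fin (m + 1) → Fin (m + 1) → ℝ} (h : ∀ k, e' k = ∑ l, Q k l • e l) :
    chartFrame c ⟨x, e'⟩ = frameRot Q (chartFrame c ⟨x, e⟩) := by
  refine Prod.ext rfl (funext fun k => ?_)
  rw [frameRot_snd]
  change coordsL c x (e' k) = ∑ l, Q k l • coordsL c x (e l)
  rw [h, map_sum]
  simp only [map_smul]

theorem exists_rot_frame (u : OFrame m M) {Q : Fin (m + 1) → Fin (m + 1) → ℝ}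
    (hQ : IsFrameRot Q) : ∃ u' : OFrame m M, proj u' = proj u ∧ u'.pt = u.pt ∧
      ∀ c, chartFrame c u' = frameRot Q (chartFrame c u) := by
  obtain ⟨x, e⟩ := u
  obtain ⟨e', he'⟩ := exists_orthonormalBasis_rot (G := TangentSpace (𝓡 (m + 1)) x) e hQ
  refine ⟨⟨x, e'⟩, Subtype.ext ?_, rfl, fun c => chartFrame_of_rot c e e' he'⟩
  have h0 : e' 0 = e 0 := by simp [he', hQ.row_zero]
  change (⟨x, e' 0⟩ : TangentBundle (𝓡 (m + 1)) M) = ⟨x, e 0⟩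
  rw [h0]

/-- The matrix of scalar products between the two frames is orthogonal and fixes the first index. -/
theorem exists_rot_of_proj_eq {u u' : OFrame m M} (h : proj u' = proj u) :
    u'.pt = u.pt ∧ ∃ Q, IsFrameRot Q ∧ ∀ c, chartFrame c u' = frameRot Q (chartFrame c u) := by
  obtain ⟨x, e⟩ := u
  obtain ⟨x', e'⟩ := u'
  have h1 : (⟨x', e' 0⟩ : TangentBundle (𝓡 (m + 1)) M) = ⟨x, e 0⟩ := congrArg Subtype.val h
  obtain ⟨rfl, h2⟩ := (TotalSpace.mk.injEq _ _ _ _).mp h1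
  have h3 : e' 0 = e 0 := eq_of_heq h2
  refine ⟨rfl, _, isFrameRot_inner (G := TangentSpace (𝓡 (m + 1)) x') e e' h3, fun c => ?_⟩
  exact chartFrame_of_rot c e e' fun k => (e.sum_repr' (e' k)).symm

end FrameRotation

end VSBM

end

noncomputable section

namespace VSBM

/-! ### The operators on the unit tangent bundle in frame coordinates -/

section Descent

variable {m : ℕ} {M : Type*} [TopologicalSpace M] [ChartedSpace (Mod m) M]
  [RiemannianBundle (fun x : M => TangentSpace (𝓡 (m + 1)) x)]
  {c : M} {D : Set (Mod m × Mod m)} (hD : IsOpen D) (hDW : ∀ p ∈ D, p.1 ∈ chartDom c)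

/-- A rotation invariant function is also represented by the rotations of its representative. -/
theorem Represents.pullRot {g : UnitTangent m M → ℝ} {φ : smoothOn (frameSet m D)}
    (hφ : Represents c (frameSet m D) (g ∘ proj) φ.1) {Q : Fin (m + 1) → Fin (m + 1) → ℝ}
    (hQ : IsFrameRot Q) : Represents c (frameSet m D) (g ∘ proj) (pullRot hQ φ).1 := by
  intro u hu huN
  obtain ⟨u', hproj, hpt, hcf⟩ := exists_rot_frame u hQ
  have h := hφ u' (by rwa [hpt]) (by rw [hcf]; exact (frameRot_mem hQ).2 huN)
  rw [hcf] at h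
  rw [← show (g ∘ proj) u' = (g ∘ proj) u from congrArg g hproj, h]
  rfl

variable (c) in
/-- The derivations `X` represent the operators `T`, and are rotated with the frames. -/
structure IsRotFamily (T : Fin (m + 1) → (OFrame m M → ℝ) → OFrame m M → ℝ)
    (X : Fin (m + 1) → Derivation ℝ (smoothOn (frameSet m D)) (smoothOn (frameSet m D))) :
    Prop where
  represents : ∀ a {F : OFrame m M → ℝ} {φ : smoothOn (frameSet m D)},
    Represents c (frameSet m D) F φ.1 → Represents c (frameSet m D) (T a F) (X a φ).1
  rot : ∀ {Q : Fin (m + 1) → Fin (m + 1) → ℝ} (hQ : IsFrameRot Q) (a : Fin (m + 1))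
    (φ : smoothOn (frameSet m D)), pullRot hQ (X a φ) = ∑ l, Q a l • X l (pullRot hQ φ)

theorem smoothOn.sum_smul_apply {ι P : Type*} [NormedAddCommGroup P] [NormedSpace ℝ P]
    [Fintype ι] {N : Set P} (r : ι → ℝ) (ψ : ι → smoothOn N) (z : P) :
    (∑ l, r l • ψ l : smoothOn N).1 z = ∑ l, r l * (ψ l).1 z := by
  rw [AddSubmonoidClass.coe_finsetSum, Finset.sum_apply]
  rfl

namespace IsRotFamily

variable {T : Fin (m + 1) → (OFrame m M → ℝ) → OFrame m M → ℝ}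
  {X : Fin (m + 1) → Derivation ℝ (smoothOn (frameSet m D)) (smoothOn (frameSet m D))}
  (h : IsRotFamily c T X) {g : UnitTangent m M → ℝ} {φ : smoothOn (frameSet m D)}
  (hφ : Represents c (frameSet m D) (g ∘ proj) φ.1)
  {u u' : OFrame m M} (hu : u.pt ∈ (extChartAt (𝓡 (m + 1)) c).source)
  (huN : chartFrame c u ∈ frameSet m D)
  {Q : Fin (m + 1) → Fin (m + 1) → ℝ} (hQ : IsFrameRot Q)
  (hcf : chartFrame c u' = frameRot Q (chartFrame c u))

include h hφ hu huN hQ hcf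

theorem apply_rot (a : Fin (m + 1)) :
    (X a φ).1 (chartFrame c u') = ∑ l, Q a l * (X l φ).1 (chartFrame c u) := by
  have h1 := congrArg (fun ψ : smoothOn (frameSet m D) => ψ.1 (chartFrame c u)) (h.rot hQ a φ)
  rw [smoothOn.sum_smul_apply] at h1
  rw [hcf]
  refine h1.trans (Finset.sum_congr rfl fun l _ => ?_)
  -- `φ` and its rotation may differ away from orthonormal frames, but they represent the same
  -- function on `OM`, so their derivatives along fields tangent to `OM` agree at `u`.
  rw [← h.represents l hφ u hu huN, ← h.represents l (hφ.pullRot hQ) u hu huN]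

theorem apply_apply_rot (a b : Fin (m + 1)) :
    (X a (X b φ)).1 (chartFrame c u')
      = ∑ k, ∑ l, Q a k * Q b l * (X k (X l φ)).1 (chartFrame c u) := by
  have h1 := congrArg (fun ψ : smoothOn (frameSet m D) => ψ.1 (chartFrame c u))
    (h.rot hQ a (X b φ))
  rw [smoothOn.sum_smul_apply] at h1
  rw [hcf]
  refine h1.trans (Finset.sum_congr rfl fun k _ => ?_)
  rw [h.rot hQ b φ, map_sum]
  simp only [Derivation.map_smul]
  rw [smoothOn.sum_smul_apply, Finset.mul_sum]
  refine Finset.sum_congr rfl fun l _ => ?_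
  rw [← h.represents k (h.represents l hφ) u hu huN,
    ← h.represents k (h.represents l (hφ.pullRot hQ)) u hu huN, mul_assoc]

end IsRotFamily

/-- `K` is evaluated in the arbitrary frame `someFrame p`. As `u` and that frame are related by a
rotation, it suffices that `F` in any rotated frame has the value of `χ` at `u`. -/
theorem represents_of_rot {K : UnitTangent m M → ℝ} {χ : smoothOn (frameSet m D)}
    (F : OFrame m M → ℝ) (hK : ∀ p, K p = F (someFrame p))
    (h : ∀ u u' : OFrame m M, u.pt ∈ (extChartAt (𝓡 (m + 1)) c).source →
      chartFrame c u ∈ frameSet m D → u'.pt ∈ (extChartAt (𝓡 (m + 1)) c).source →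
      chartFrame c u' ∈ frameSet m D → ∀ Q, IsFrameRot Q →
      chartFrame c u' = frameRot Q (chartFrame c u) → F u' = χ.1 (chartFrame c u)) :
    Represents c (frameSet m D) (K ∘ proj) χ.1 := by
  intro u hu huN
  obtain ⟨hpt, Q, hQ, hcf⟩ := exists_rot_of_proj_eq
    (show proj (someFrame (proj u)) = proj u from (exists_frame (proj u)).choose_spec)
  refine (hK _).trans (h u _ hu huN (by rwa [hpt]) ?_ Q hQ (hcf c))
  rw [hcf]
  exact (frameRot_mem hQ).2 huN

variable {f g : UnitTangent m M → ℝ} {φ ψ : smoothOn (frameSet m D)}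

theorem sum_mul_rot {T S : Fin (m + 1) → (OFrame m M → ℝ) → OFrame m M → ℝ}
    {X Y : Fin (m + 1) → Derivation ℝ (smoothOn (frameSet m D)) (smoothOn (frameSet m D))}
    (hX : IsRotFamily c T X) (hY : IsRotFamily c S Y)
    (hf : Represents c (frameSet m D) (f ∘ proj) φ.1)
    (hg : Represents c (frameSet m D) (g ∘ proj) ψ.1) {u u' : OFrame m M}
    (hu : u.pt ∈ (extChartAt (𝓡 (m + 1)) c).source) (huN : chartFrame c u ∈ frameSet m D)
    (hu' : u'.pt ∈ (extChartAt (𝓡 (m + 1)) c).source) (huN' : chartFrame c u' ∈ frameSet m D)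
    {Q : Fin (m + 1) → Fin (m + 1) → ℝ} (hQ : IsFrameRot Q)
    (hcf : chartFrame c u' = frameRot Q (chartFrame c u)) :
    ∑ i : Fin m, T i.succ (f ∘ proj) u' * S i.succ (g ∘ proj) u'
      = (∑ i : Fin m, X i.succ φ * Y i.succ ψ : smoothOn (frameSet m D)).1 (chartFrame c u) := by
  have h1 : (∑ i : Fin m, X i.succ φ * Y i.succ ψ : smoothOn (frameSet m D)).1 (chartFrame c u)
      = ∑ i : Fin m, (X i.succ φ).1 (chartFrame c u) * (Y i.succ ψ).1 (chartFrame c u) := by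
    rw [AddSubmonoidClass.coe_finsetSum, Finset.sum_apply]
    rfl
  rw [h1]
  simp only [hX.represents _ hf u' hu' huN', hY.represents _ hg u' hu' huN']
  refine hQ.sum_succ (T' := fun a b => (X a φ).1 (chartFrame c u') * (Y b ψ).1 (chartFrame c u'))
    (T := fun a b => (X a φ).1 (chartFrame c u) * (Y b ψ).1 (chartFrame c u)) fun a b => ?_
  rw [hX.apply_rot hf hu huN hQ hcf, hY.apply_rot hg hu huN hQ hcf, Finset.sum_mul_sum]
  exact Finset.sum_congr rfl fun k _ => Finset.sum_congr rfl fun l _ => by ring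

theorem IsRotFamily.apply_zero_rot {T : Fin (m + 1) → (OFrame m M → ℝ) → OFrame m M → ℝ}
    {X : Fin (m + 1) → Derivation ℝ (smoothOn (frameSet m D)) (smoothOn (frameSet m D))}
    (hX : IsRotFamily c T X) (hf : Represents c (frameSet m D) (f ∘ proj) φ.1) {u u' : OFrame m M}
    (hu : u.pt ∈ (extChartAt (𝓡 (m + 1)) c).source) (huN : chartFrame c u ∈ frameSet m D)
    {Q : Fin (m + 1) → Fin (m + 1) → ℝ} (hQ : IsFrameRot Q)
    (hcf : chartFrame c u' = frameRot Q (chartFrame c u)) :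
    (X 0 φ).1 (chartFrame c u') = (X 0 φ).1 (chartFrame c u) := by
  simp [hX.apply_rot hf hu huN hQ hcf, hQ.row_zero]

variable [IsManifold (𝓡 (m + 1)) ∞ M]
  [IsContMDiffRiemannianBundle (𝓡 (m + 1)) ∞ (Mod m)
      (fun x : M => TangentSpace (𝓡 (m + 1)) x)]

/-- The derivations along the vertical fields in the chart. -/
def chartVert (a : Fin (m + 1)) :
    Derivation ℝ (smoothOn (frameSet m D)) (smoothOn (frameSet m D)) :=
  vertDer (isOpen_frameSet hD) a

/-- The derivations along the horizontal fields in the chart around `c`. -/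
def chartHor (a : Fin (m + 1)) :
    Derivation ℝ (smoothOn (frameSet m D)) (smoothOn (frameSet m D)) :=
  horDer (contDiffOn_chris c) (isOpen_frameSet hD) (fun _ hz => hDW _ hz) a


/-- The zero operator at index `0` matches the vanishing of `vertField 0`, so that the same `n × n`
matrix `Q` rotates both families. -/
theorem isRotFamily_vert :
    IsRotFamily (M := M) c (fun a => Fin.cases (fun _ _ => 0) (fun i => V i) a) (chartVert hD) where
  represents a F φ hF := by
    intro u hu huN
    induction a using Fin.cases with
    | zero =>
      rw [chartVert, vertDer_zero]
      rfl
    | succ i =>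
      exact (V_eq hF (isOpen_frameSet hD) hu huN
        (smoothOn.differentiableAt (isOpen_frameSet hD) φ huN) i).trans
        (vertDer_apply (isOpen_frameSet hD) i.succ φ huN).symm
  rot hQ a φ := pullRot_lieDer hD hQ (fun a => contDiffOn_vertField a) a
    (fun z => vertField_frameRot hQ a z) φ

theorem isRotFamily_hor : IsRotFamily (M := M) c H (chartHor hD hDW) where
  represents a F φ hF := by
    intro u hu huN
    exact (H_eq hF (isOpen_frameSet hD) hu huN
      (smoothOn.differentiableAt (isOpen_frameSet hD) φ huN) a).trans
      (horDer_apply (contDiffOn_chris c) (isOpen_frameSet hD) (fun _ hz => hDW _ hz) a φ huN).symm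
  rot {Q} hQ a φ := pullRot_lieDer hD hQ
    (fun a => contDiffOn_horField (contDiffOn_chris c) (fun _ hz => hDW _ hz) a) a
    (fun z => horField_frameRot (chris c) Q a z) φ

theorem represents_gammaV (hf : Represents c (frameSet m D) (f ∘ proj) φ.1)
    (hg : Represents c (frameSet m D) (g ∘ proj) ψ.1) :
    Represents c (frameSet m D) (gammaV f g ∘ proj)
      (∑ i : Fin m, chartVert hD i.succ φ * chartVert hD i.succ ψ :
        smoothOn (frameSet m D)).1 :=
  represents_of_rot (fun u => ∑ i, V i (f ∘ proj) u * V i (g ∘ proj) u) (fun _ => rfl)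
    fun _ _ hu huN hu' huN' _ hQ hcf =>
      sum_mul_rot (isRotFamily_vert hD) (isRotFamily_vert hD) hf hg hu huN hu' huN' hQ hcf

theorem represents_gammaH (hf : Represents c (frameSet m D) (f ∘ proj) φ.1)
    (hg : Represents c (frameSet m D) (g ∘ proj) ψ.1) :
    Represents c (frameSet m D) (gammaH f g ∘ proj)
      (∑ i : Fin m, chartHor hD hDW i.succ φ * chartHor hD hDW i.succ ψ :
        smoothOn (frameSet m D)).1 :=
  represents_of_rot (fun u => ∑ i : Fin m, H i.succ (f ∘ proj) u * H i.succ (g ∘ proj) u)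
    (fun _ => rfl) fun _ _ hu huN hu' huN' _ hQ hcf =>
      sum_mul_rot (isRotFamily_hor hD hDW) (isRotFamily_hor hD hDW) hf hg hu huN hu' huN' hQ hcf

theorem represents_gammaVH (hf : Represents c (frameSet m D) (f ∘ proj) φ.1)
    (hg : Represents c (frameSet m D) (g ∘ proj) ψ.1) :
    Represents c (frameSet m D) (gammaVH f g ∘ proj)
      ((1 / 2 : ℝ) • (∑ i : Fin m, chartHor hD hDW i.succ φ * chartVert hD i.succ ψ
        + ∑ i : Fin m, chartHor hD hDW i.succ ψ * chartVert hD i.succ φ) :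
        smoothOn (frameSet m D)).1 := by
  refine represents_of_rot (fun u => (1 / 2) * ∑ i : Fin m,
      (H i.succ (f ∘ proj) u * V i (g ∘ proj) u
      + H i.succ (g ∘ proj) u * V i (f ∘ proj) u)) (fun _ => rfl)
    fun u u' hu huN hu' huN' Q hQ hcf => ?_
  have h1 := sum_mul_rot (isRotFamily_hor hD hDW) (isRotFamily_vert hD) hf hg hu huN hu' huN' hQ hcf
  have h2 := sum_mul_rot (isRotFamily_hor hD hDW) (isRotFamily_vert hD) hg hf hu huN hu' huN' hQ hcf
  rw [Finset.sum_add_distrib]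
  exact congrArg (fun r : ℝ => 1 / 2 * r) (congrArg₂ (· + ·) h1 h2)

theorem represents_xi (hf : Represents c (frameSet m D) (f ∘ proj) φ.1) :
    Represents c (frameSet m D) (xi f ∘ proj) (chartHor hD hDW 0 φ).1 :=
  represents_of_rot (fun u => H 0 (f ∘ proj) u) (fun _ => rfl)
    fun _ _ hu huN hu' huN' _ hQ hcf =>
      ((isRotFamily_hor hD hDW).represents 0 hf _ hu' huN').trans
        ((isRotFamily_hor hD hDW).apply_zero_rot hf hu huN hQ hcf)

theorem represents_gammaXi (hf : Represents c (frameSet m D) (f ∘ proj) φ.1)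
    (hg : Represents c (frameSet m D) (g ∘ proj) ψ.1) :
    Represents c (frameSet m D) (gammaXi f g ∘ proj)
      (chartHor hD hDW 0 φ * chartHor hD hDW 0 ψ : smoothOn (frameSet m D)).1 := by
  intro u hu huN
  exact congrArg₂ (· * ·) (represents_xi hD hDW hf u hu huN) (represents_xi hD hDW hg u hu huN)

/-- The generator in the chart around `c`. -/
def chartGen (σ κ : ℝ) (φ : smoothOn (frameSet m D)) : smoothOn (frameSet m D) :=
  algGen (σ ^ 2 / 2) κ (fun i : Fin m => chartVert hD i.succ) (chartHor hD hDW) φ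

theorem chartGen_apply (σ κ : ℝ) (φ : smoothOn (frameSet m D)) (z : FrameSpace m (Mod m)) :
    (chartGen hD hDW σ κ φ).1 z = σ ^ 2 / 2 *
      ∑ i : Fin m, (chartVert hD i.succ (chartVert hD i.succ φ)).1 z
      + κ * (chartHor hD hDW 0 φ).1 z := by
  rw [← Finset.sum_apply, ← AddSubmonoidClass.coe_finsetSum]
  rfl

theorem represents_gen (σ κ : ℝ) (hf : Represents c (frameSet m D) (f ∘ proj) φ.1) :
    Represents c (frameSet m D) (gen σ κ f ∘ proj) (chartGen hD hDW σ κ φ).1 := by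
  refine represents_of_rot (frameGen σ κ (f ∘ proj)) (fun _ => rfl)
    fun u u' hu huN hu' huN' Q hQ hcf => ?_
  have hV := isRotFamily_vert (c := c) hD
  have h1 : ∀ i : Fin m, V i (V i (f ∘ proj)) u'
      = (chartVert hD i.succ (chartVert hD i.succ φ)).1 (chartFrame c u') := fun i =>
    hV.represents i.succ (hV.represents i.succ hf) u' hu' huN'
  rw [chartGen_apply, frameGen]
  simp only [h1]
  rw [hQ.sum_succ fun a b => hV.apply_apply_rot hf hu huN hQ hcf a b,
    (isRotFamily_hor hD hDW).represents 0 hf u' hu' huN',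
    (isRotFamily_hor hD hDW).apply_zero_rot hf hu huN hQ hcf]

end Descent

end VSBM

end

noncomputable section

namespace VSBM

/-! ### Smooth functions on the unit tangent bundle in frame coordinates -/

section Pullback

variable {m : ℕ} {E : Type*} [NormedAddCommGroup E] [NormedSpace ℝ E] {D : Set (E × E)}

/-- The base point and the first vector of a frame, as a linear map. -/
def firstProj (m : ℕ) : FrameSpace m E →L[ℝ] E × E :=
  (ContinuousLinearMap.fst ℝ E (Fin (m + 1) → E)).prod (frameProj 0)

/-- A function of the base point and the first vector, as a function of the frame. -/
def pullFirst (m : ℕ) {h : E × E → ℝ} (hh : ContDiffOn ℝ ∞ h D) : smoothOn (frameSet m D) :=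
  ⟨fun z => h (z.1, z.2 0), ContDiffOn.comp hh
    (ContDiff.contDiffOn (ContinuousLinearMap.contDiff (firstProj (E := E) m))) fun _ hz => hz⟩

theorem dependsOnFirst_pullFirst (hD : IsOpen D) {h : E × E → ℝ} (hh : ContDiffOn ℝ ∞ h D) :
    DependsOnFirst (pullFirst m hh) := by
  intro z hz v h1 h2
  have h3 : DifferentiableAt ℝ h (firstProj m z) :=
    (hh.contDiffAt (hD.mem_nhds hz)).differentiableAt (by simp)
  have h4 := HasFDerivAt.comp (f := firstProj (E := E) m) z h3.hasFDerivAt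
    (ContinuousLinearMap.hasFDerivAt (firstProj (E := E) m))
  have h5 : firstProj m v = 0 := Prod.ext h1 h2
  refine (congrArg (fun T => T v) h4.fderiv).trans ?_
  simp [h5]

end Pullback

section Extension

variable {m : ℕ} {M : Type*} [TopologicalSpace M] [ChartedSpace (Mod m) M]
  [IsManifold (𝓡 (m + 1)) ∞ M]

/-- The tangent vector with given coordinates in the chart around `c`. -/
def tangentOf (c : M) (p : Mod m × Mod m) : TangentBundle (𝓡 (m + 1)) M :=
  ⟨ptOf c p.1, vecOf c (ptOf c p.1) p.2⟩

theorem tangentOf_coords {c x : M} (hx : x ∈ (extChartAt (𝓡 (m + 1)) c).source)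
    (X : TangentSpace (𝓡 (m + 1)) x) :
    tangentOf c (extChartAt (𝓡 (m + 1)) c x, coords c x X) = ⟨x, X⟩ := by
  have h : ∀ x' : M, x' = x → ∀ w,
      (⟨x', vecOf c x' w⟩ : TangentBundle (𝓡 (m + 1)) M) = ⟨x, vecOf c x w⟩ := by
    rintro x' rfl w; rfl
  refine (h _ (ptOf_ext hx) _).trans ?_
  change (⟨x, vecOf c x (coords c x X)⟩ : TangentBundle (𝓡 (m + 1)) M) = _
  rw [vecOf_coords hx]

variable [RiemannianBundle (fun x : M => TangentSpace (𝓡 (m + 1)) x)]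

/-- A local smooth extension of `f` to `TM`, read through the inverse tangent chart, is a function
of `(y, e^0)`; it is lifted to tuples of vectors by ignoring the others. -/
theorem SmoothOnUnitTangent.exists_represents {f : UnitTangent m M → ℝ}
    (hf : SmoothOnUnitTangent f) (u : OFrame m M) :
    ∃ D : Set (Mod m × Mod m), IsOpen D ∧ (∀ p ∈ D, p.1 ∈ chartDom u.pt) ∧
      chartFrame u.pt u ∈ frameSet m D ∧ ∃ φ : smoothOn (frameSet m D),
        Represents u.pt (frameSet m D) (f ∘ proj) φ.1 ∧ DependsOnFirst φ := by
  obtain ⟨U, hU, huU, g, hg, hfg⟩ := hf (proj u)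
  have hopen : IsOpen {p : Mod m × Mod m | p.1 ∈ chartDom u.pt} :=
    (isOpen_chartDom u.pt).preimage continuous_fst
  have hsm : ContMDiffOn 𝓘(ℝ, Mod m × Mod m) (𝓡 (m + 1)).tangent ∞ (tangentOf u.pt)
      {p | p.1 ∈ chartDom u.pt} := fun p hp => (contMDiffAt_vecOf hp).contMDiffWithinAt
  have hD : IsOpen ({p : Mod m × Mod m | p.1 ∈ chartDom u.pt} ∩ tangentOf u.pt ⁻¹' U) :=
    hsm.continuousOn.isOpen_inter_preimage hopen hU
  have hh : ContDiffOn ℝ ∞ (g ∘ tangentOf u.pt)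
      ({p : Mod m × Mod m | p.1 ∈ chartDom u.pt} ∩ tangentOf u.pt ⁻¹' U) :=
    (hg.comp (hsm.mono Set.inter_subset_left) fun p hp => hp.2).contDiffOn
  have hself := mem_extChartAt_source (I := 𝓡 (m + 1)) u.pt
  refine ⟨_, hD, fun p hp => hp.1, ⟨ext_mem hself, ?_⟩, pullFirst m hh, ?_,
    dependsOnFirst_pullFirst hD hh⟩
  · change tangentOf u.pt (extChartAt (𝓡 (m + 1)) u.pt u.pt, coords u.pt u.pt (u.e 0)) ∈ U
    rw [tangentOf_coords hself]
    exact huU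
  · intro u' hu' huN'
    have h1 : tangentOf u.pt ((chartFrame u.pt u').1, (chartFrame u.pt u').2 0) = (proj u').1 :=
      tangentOf_coords hu' (u'.e 0)
    have h2 : (proj u').1 ∈ U := by
      rw [← h1]
      exact huN'.2
    refine (hfg _ h2).trans ?_
    rw [← h1]
    rfl

end Extension

/-! ### The curvature tensor in coordinates -/

section Curvature

theorem curv_sum_smul {ι E : Type*} [NormedAddCommGroup E] [NormedSpace ℝ E] [Fintype ι]
    (Γ : E → E →L[ℝ] E →L[ℝ] E) (y Y Z : E) (r : ι → ℝ) (X : ι → E) :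
    curv Γ y (∑ i, r i • X i) Y Z = ∑ i, r i • curv Γ y (X i) Y Z := by
  simp only [curv, map_sum, map_smul, sum_apply, smul_apply, smul_add, smul_sub,
    Finset.sum_add_distrib, Finset.sum_sub_distrib]

variable {m : ℕ} {M : Type*} [TopologicalSpace M] [ChartedSpace (Mod m) M]
  [RiemannianBundle (fun x : M => TangentSpace (𝓡 (m + 1)) x)]
  [IsManifold (𝓡 (m + 1)) ∞ M]
  [IsContMDiffRiemannianBundle (𝓡 (m + 1)) ∞ (Mod m)
      (fun x : M => TangentSpace (𝓡 (m + 1)) x)]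

theorem fderiv_chris_apply (c : M) {y : Mod m} (hy : y ∈ chartDom c) (X Y Z : Mod m)
    (l : Fin (m + 1)) :
    fderiv ℝ (chris c) y X Y Z l
      = ∑ i, ∑ j, ∑ k, pd i (christoffel c l j k) y * X i * Y j * Z k := by
  have h1 : HasFDerivAt (chris c) (fderiv ℝ (chris c) y) y :=
    (isLeviCivita c).hasFDerivAt hy
  have h2 : HasFDerivAt (fun y => coordFn l (chris c y Y Z))
      ((coordFn l).comp (((fderiv ℝ (chris c) y).flip Y).flip Z)) y := by
    have h3 := (coordFn (m := m) l).hasFDerivAt.comp y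
      ((h1.clm_apply (hasFDerivAt_const Y y)).clm_apply (hasFDerivAt_const Z y))
    refine h3.congr_fderiv ?_
    ext w
    simp
  have h4 : HasFDerivAt (fun y => coordFn l (chris c y Y Z))
      (∑ j, ∑ k, (Y j * Z k) • fderiv ℝ (christoffel c l j k) y) y := by
    have h5 : (fun y => coordFn l (chris c y Y Z))
        = fun y => ∑ j, ∑ k, (Y j * Z k) • christoffel c l j k y := by
      funext y
      rw [coordFn_apply, chris_apply]
      exact Finset.sum_congr rfl fun j _ => Finset.sum_congr rfl fun k _ => by
        rw [smul_eq_mul]; ring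
    rw [h5]
    refine HasFDerivAt.fun_sum fun j _ => HasFDerivAt.fun_sum fun k _ => ?_
    exact (((contDiffOn_christoffel c l j k).contDiffAt
      ((isOpen_chartDom c).mem_nhds hy)).differentiableAt
        (by simp)).hasFDerivAt.const_smul (Y j * Z k)
  have h6 := congrArg (fun T => T X) (h2.unique h4)
  simp only [sum_apply, smul_apply, fderiv_eq_sum_pd, smul_eq_mul, Finset.mul_sum] at h6
  refine Eq.trans h6 ?_
  refine (Finset.sum_congr rfl fun j _ => Finset.sum_comm).trans (Finset.sum_comm.trans ?_)
  exact Finset.sum_congr rfl fun i _ => Finset.sum_congr rfl fun j _ =>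
    Finset.sum_congr rfl fun k _ => by ring

omit [IsManifold (𝓡 (m + 1)) ∞ M] [IsContMDiffRiemannianBundle (𝓡 (m + 1)) ∞ (Mod m)
      (fun x : M => TangentSpace (𝓡 (m + 1)) x)] in
theorem chris_chris_apply (c : M) (y X Y Z : Mod m) (l : Fin (m + 1)) :
    chris c y X (chris c y Y Z) l
      = ∑ i, ∑ j, ∑ k, (∑ p, christoffel c l i p y * christoffel c p j k y)
        * X i * Y j * Z k := by
  simp only [chris_apply, Finset.mul_sum, Finset.sum_mul]
  refine Finset.sum_congr rfl fun i _ => Finset.sum_comm.trans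
    (Finset.sum_congr rfl fun j _ => Finset.sum_comm.trans
      (Finset.sum_congr rfl fun k _ => Finset.sum_congr rfl fun p _ => by ring))

/-- Identifies the index definition of the tensor with the invariant expression `curv`, for which
the symmetries are known. -/
theorem riemann_coords (x : M) (X Y Z : TangentSpace (𝓡 (m + 1)) x) :
    coords x x (riemann x X Y Z)
      = curv (chris x) (extChartAt (𝓡 (m + 1)) x x) (coords x x X) (coords x x Y)
        (coords x x Z) := by
  have hself := mem_extChartAt_source (I := 𝓡 (m + 1)) x
  have hy := ext_mem hself
  rw [riemann, coords_vecOf hself]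
  ext l
  simp only [curv, PiLp.add_apply, PiLp.sub_apply, fderiv_chris_apply x hy, chris_chris_apply]
  rw [Finset.sum_comm (f := fun i j => ∑ k, pd i (christoffel x l j k)
      (extChartAt (𝓡 (m + 1)) x x) * coords x x Y i * coords x x X j * coords x x Z k),
    Finset.sum_comm (f := fun i j => ∑ k, (∑ p, christoffel x l i p (extChartAt (𝓡 (m + 1)) x x)
      * christoffel x p j k (extChartAt (𝓡 (m + 1)) x x))
      * coords x x Y i * coords x x X j * coords x x Z k)]
  simp only [← Finset.sum_sub_distrib, ← Finset.sum_add_distrib]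
  refine Finset.sum_congr rfl fun i _ => Finset.sum_congr rfl fun j _ =>
    Finset.sum_congr rfl fun k _ => ?_
  rw [riemannCoeff, Finset.sum_sub_distrib]
  ring

end Curvature

end VSBM

end

noncomputable section

namespace VSBM

/-! ### The iterated operators in the algebra -/

namespace FrameRelations

variable {m : ℕ} {A : Type*} [CommRing A] [Algebra ℝ A] {s κ : ℝ} {V : Fin m → Derivation ℝ A A}
  {H : Fin (m + 1) → Derivation ℝ A A} {a : A} {ρ : Fin m → A}

/-- The algebraic core of `Γ₂`: with `x' i` and `y' i` the fields applied to `La`, the differences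
on the right are commutators of `L` with the fields. -/
theorem algGen_sum_mul {ι : Type*} [Fintype ι] (x y x' y' : ι → A) :
    algGen s κ V H (∑ i, x i * y i) - (∑ i, x' i * y i + ∑ i, x i * y' i)
      = ∑ i, (algGen s κ V H (x i) - x' i) * y i + ∑ i, x i * (algGen s κ V H (y i) - y' i)
        + (2 * s) • ∑ i, ∑ j, V j (x i) * V j (y i) := by
  have h1 : algGen s κ V H (∑ i, x i * y i) = ∑ i, algGen s κ V H (x i * y i) := by
    simp only [algGen, map_sum, Finset.sum_add_distrib, ← Finset.smul_sum]
    rw [Finset.sum_comm]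
  rw [h1]
  simp only [algGen_mul, sub_mul, mul_sub, Finset.sum_add_distrib, Finset.sum_sub_distrib,
    ← Finset.smul_sum]
  abel

variable (h : FrameRelations V H a ρ) (ε : A →ₐ[ℝ] ℝ)

include h

/-- Both factors give the same commutator, hence the overall `2` that cancels the `½` in `Γ₂`. Here
`m - 1 = n - 2`. -/
theorem eval_vert :
    ε (algGen s κ V H (∑ i, V i a * V i a)
      - (∑ i, V i (algGen s κ V H a) * V i a + ∑ i, V i a * V i (algGen s κ V H a)))
      = 2 * (s * (∑ i, ∑ j, ε (V i (V j a)) * ε (V i (V j a))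
        + ((m : ℝ) - 1) * ∑ i, ε (V i a) * ε (V i a)) - κ * ∑ i, ε (V i a) * ε (H i.succ a)) := by
  rw [algGen_sum_mul, Finset.sum_comm (f := fun i j => V j (V i a) * V j (V i a))]
  simp only [h.gen_vert, map_add, map_sum, map_mul, map_sub, map_smul, smul_eq_mul, sub_mul,
    mul_sub, Finset.sum_sub_distrib, Finset.mul_sum, mul_add]
  simp only [mul_assoc, mul_left_comm (ε _), ← Finset.mul_sum, mul_comm (ε (H _ a)) (ε (V _ a))]
  ring

/-- The coefficient `m / 2` is half of `(m - 1) + 1`: the first term comes from `gen_vert`, the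
second from `gen_hor`. -/
theorem eval_vert_hor :
    ε (algGen s κ V H (∑ i, H i.succ a * V i a)
      - (∑ i, H i.succ (algGen s κ V H a) * V i a + ∑ i, H i.succ a * V i (algGen s κ V H a)))
      = 2 * (s * (∑ i, ∑ j, ε (V i (V j a)) * ε (V i (H j.succ a))
        + (m : ℝ) / 2 * ∑ i, ε (V i a) * ε (H i.succ a) - ∑ i, ε (V i (H 0 a)) * ε (V i a))
        + κ / 2 * (∑ i, ε (ρ i) * ε (V i a) - ∑ i : Fin m, ε (H i.succ a) * ε (H i.succ a))) := by
  rw [algGen_sum_mul, Finset.sum_comm (f := fun i j => V j (H i.succ a) * V j (V i a))]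
  simp only [h.gen_vert, h.gen_hor, map_add, map_sum, map_mul, map_sub, map_smul, smul_eq_mul,
    sub_mul, add_mul, mul_sub, Finset.sum_sub_distrib, Finset.sum_add_distrib, mul_add]
  simp only [mul_assoc, mul_left_comm (ε _), ← Finset.mul_sum, mul_comm (ε (H _ a)) (ε (V _ a)),
    mul_comm (ε (V _ (H _ a))) (ε (V _ (V _ a)))]
  ring

theorem eval_hor :
    ε (algGen s κ V H (∑ i : Fin m, H i.succ a * H i.succ a)
      - (∑ i : Fin m, H i.succ (algGen s κ V H a) * H i.succ a
        + ∑ i : Fin m, H i.succ a * H i.succ (algGen s κ V H a)))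
      = 2 * (s * (∑ i, ∑ j : Fin m, ε (V i (H j.succ a)) * ε (V i (H j.succ a))
        + ∑ i : Fin m, ε (H i.succ a) * ε (H i.succ a)
        - 2 * ∑ i, ε (V i (H 0 a)) * ε (H i.succ a))
        + κ * ∑ i, ε (ρ i) * ε (H i.succ a)) := by
  rw [algGen_sum_mul,
    Finset.sum_comm (f := fun (i j : Fin m) => V j (H i.succ a) * V j (H i.succ a))]
  simp only [h.gen_hor, map_add, map_sum, map_mul, map_sub, map_smul, smul_eq_mul,
    sub_mul, add_mul, mul_sub, Finset.sum_sub_distrib, Finset.sum_add_distrib, mul_add]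
  simp only [mul_assoc, mul_left_comm (ε (H _ a)), ← Finset.mul_sum,
    mul_comm (ε (H _ a)) (ε (V _ _)), mul_comm (ε (H _ a)) (ε (ρ _))]
  ring

theorem eval_geod :
    ε (algGen s κ V H (H 0 a * H 0 a)
      - (H 0 (algGen s κ V H a) * H 0 a + H 0 a * H 0 (algGen s κ V H a)))
      = 2 * (s * (∑ i, ε (V i (H 0 a)) * ε (V i (H 0 a)) + (m : ℝ) * (ε (H 0 a) * ε (H 0 a))
        + 2 * (∑ i, ε (V i (H i.succ a))) * ε (H 0 a))) := by
  have h1 := h.gen_geod (s := s) (κ := κ)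
  rw [sub_eq_iff_eq_add] at h1
  rw [algGen_mul, h1]
  simp only [map_add, map_sum, map_mul, map_sub, map_smul, smul_eq_mul]
  ring

end FrameRelations

/-! ### The curvature term -/

section CurvatureTerm

/-- Evaluation at a point of the functions smooth on `N`. -/
def evalAt {P : Type*} [NormedAddCommGroup P] [NormedSpace ℝ P] {N : Set P} (z : P) :
    smoothOn N →ₐ[ℝ] ℝ :=
  (Pi.evalAlgHom ℝ (fun _ : P => ℝ) z).comp (smoothOn N).val

variable {m : ℕ} {M : Type*} [TopologicalSpace M] [ChartedSpace (Mod m) M]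
  [RiemannianBundle (fun x : M => TangentSpace (𝓡 (m + 1)) x)]
  [IsManifold (𝓡 (m + 1)) ∞ M]
  [IsContMDiffRiemannianBundle (𝓡 (m + 1)) ∞ (Mod m)
      (fun x : M => TangentSpace (𝓡 (m + 1)) x)]

/-- The matrix of the Jacobi operator `X ↦ R(X, e⁰)e⁰`. -/
def jacobiMat (u : OFrame m M) (i j : Fin m) : ℝ :=
  ⟪riemann u.pt (u.e i.succ) (u.e 0) (u.e 0), u.e j.succ⟫_ℝ

theorem inner_riemann (x : M) (X Y Z W : TangentSpace (𝓡 (m + 1)) x) :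
    ⟪riemann x X Y Z, W⟫_ℝ = metric x (extChartAt (𝓡 (m + 1)) x x)
      (curv (chris x) (extChartAt (𝓡 (m + 1)) x x) (coords x x X) (coords x x Y) (coords x x Z))
      (coords x x W) := by
  rw [← riemann_coords, metric_coords (mem_extChartAt_source x)]

/-- Self-adjointness of the Jacobi operator. In `Γ₂^{h̃}` the commutator pairs `V_j` with `H_i`,
whereas the stated curvature term pairs `V_i` with `H_j`. -/
theorem jacobiMat_symm (u : OFrame m M) (i j : Fin m) : jacobiMat u i j = jacobiMat u j i := by
  rw [jacobiMat, jacobiMat, inner_riemann, inner_riemann]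
  exact (isLeviCivita u.pt).jacobi_symm (ext_mem (mem_extChartAt_source u.pt)) _ _ _

theorem inner_riemann_sum (u : OFrame m M) (r t : Fin m → ℝ) :
    ⟪riemann u.pt (∑ i, r i • u.e i.succ) (u.e 0) (u.e 0), ∑ j, t j • u.e j.succ⟫_ℝ
      = ∑ i, ∑ j, r i * t j * jacobiMat u i j := by
  have h1 : ∀ r : Fin m → ℝ, coords u.pt u.pt (∑ i, r i • u.e i.succ)
      = ∑ i, r i • coords u.pt u.pt (u.e i.succ) := by
    intro r
    rw [← coordsL_apply, map_sum]
    simp only [map_smul, coordsL_apply]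
  simp only [jacobiMat, inner_riemann, h1, curv_sum_smul, map_sum, map_smul, sum_apply, smul_apply,
    smul_eq_mul, Finset.mul_sum]
  rw [Finset.sum_comm]
  exact Finset.sum_congr rfl fun i _ => Finset.sum_congr rfl fun j _ => by ring

omit [IsManifold (𝓡 (m + 1)) ∞ M] [IsContMDiffRiemannianBundle (𝓡 (m + 1)) ∞ (Mod m)
      (fun x : M => TangentSpace (𝓡 (m + 1)) x)] in
theorem inner_frame_sum (u : OFrame m M) (r t : Fin m → ℝ) :
    ⟪∑ i, r i • u.e i.succ, ∑ j, t j • u.e j.succ⟫_ℝ = ∑ i, r i * t i := by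
  simp only [sum_inner, inner_sum, real_inner_smul_left, real_inner_smul_right,
    orthonormal_iff_ite.1 u.e.orthonormal, Fin.succ_inj]
  simp [mul_comm]

variable {u : OFrame m M} {D : Set (Mod m × Mod m)} (hD : IsOpen D)
  (hDW : ∀ p ∈ D, p.1 ∈ chartDom u.pt) {φ : smoothOn (frameSet m D)} (hφ : DependsOnFirst φ)
  (huN : chartFrame u.pt u ∈ frameSet m D)

include hφ huN in
-- The bracket of `H_0` and `H_i` acts on all frame vectors by `R(e^i, e^0)`, but `φ` only sees its
-- effect on `e^0`, which is that of the combination of the `V_j` with coefficients `jacobiMat u i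
-- j`.
theorem commutator_hor_apply (i : Fin m) :
    evalAt (chartFrame u.pt u) (chartHor hD hDW 0 (chartHor hD hDW i.succ φ)
        - chartHor hD hDW i.succ (chartHor hD hDW 0 φ))
      = ∑ j, jacobiMat u i j * evalAt (chartFrame u.pt u) (chartVert hD j.succ φ) := by
  set z := chartFrame u.pt u with hz
  have hself := mem_extChartAt_source (I := 𝓡 (m + 1)) u.pt
  have hzdom : z.1 ∈ chartDom u.pt := hDW _ huN
  have hH : ∀ a, ContDiffOn ℝ ∞ (horField (chris u.pt) a) (frameSet m D) := fun a =>
    contDiffOn_horField (contDiffOn_chris u.pt) (fun _ hz => hDW _ hz) a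
  have h1 := lieDer_comm (isOpen_frameSet hD) (hH 0) (hH i.succ) φ huN
  rw [bracket_hor_hor (isOpen_chartDom u.pt) (contDiffOn_chris u.pt)
    (isLeviCivita u.pt).symm 0 i.succ hzdom] at h1
  have h2 : curv (chris u.pt) z.1 (z.2 i.succ) (z.2 0) (z.2 0)
      = ∑ j : Fin m, jacobiMat u i j • z.2 j.succ := by
    set w := riemann u.pt (u.e i.succ) (u.e 0) (u.e 0) with hw
    have h3 : ⟪u.e 0, w⟫_ℝ = 0 := by
      rw [real_inner_comm, hw, inner_riemann]
      exact (isLeviCivita u.pt).jacobi_self hzdom _ _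
    have h4 := u.e.sum_repr' w
    rw [Fin.sum_univ_succ, h3, zero_smul, zero_add] at h4
    have h5 := congrArg (coordsL u.pt u.pt) h4
    rw [map_sum] at h5
    simp only [map_smul, coordsL_apply] at h5
    rw [hw, riemann_coords] at h5
    refine h5.symm.trans (Finset.sum_congr rfl fun j _ => ?_)
    rw [real_inner_comm]
    rfl
  have h6 : fderiv ℝ φ.1 z (0, fun k => curv (chris u.pt) z.1 (z.2 i.succ) (z.2 0) (z.2 k))
      = fderiv ℝ φ.1 z (∑ j : Fin m, jacobiMat u i j • vertField j.succ z) := by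
    rw [← sub_eq_zero, ← map_sub]
    refine hφ z huN _ ?_ ?_
    · simp [Prod.fst_sum]
    · simp only [Prod.snd_sub, Pi.sub_apply, h2, Prod.snd_sum, Finset.sum_apply, Prod.smul_snd,
        Pi.smul_apply, vertField_snd, if_true, (Fin.succ_ne_zero _).symm, if_false, sub_zero,
        sub_self]
  rw [h6, map_sum] at h1
  rw [map_sub, sub_eq_iff_eq_add']
  refine h1.trans (congrArg₂ (· + ·) rfl (Finset.sum_congr rfl fun j _ => ?_))
  rw [map_smul, smul_eq_mul]
  exact congrArg (fun r => jacobiMat u i j * r)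
    (vertDer_apply (isOpen_frameSet hD) j.succ φ huN).symm

end CurvatureTerm

end VSBM

end

/-! ### The four formulas -/

set_option maxHeartbeats 400000 in
theorem lemma1 (m : ℕ) (M : Type*) [TopologicalSpace M] [ChartedSpace (VSBM.Mod m) M]
    [IsManifold (𝓡 (m + 1)) ∞ M]
    [RiemannianBundle (fun x : M => TangentSpace (𝓡 (m + 1)) x)]
    [IsContMDiffRiemannianBundle (𝓡 (m + 1)) ∞ (VSBM.Mod m)
      (fun x : M => TangentSpace (𝓡 (m + 1)) x)]
    (σ κ : ℝ) (n : ℕ) (hn : n = m + 1)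
    (f : VSBM.UnitTangent m M → ℝ) (hf : VSBM.SmoothOnUnitTangent f)
    (u : VSBM.OFrame m M) :
    VSBM.gammaTwo σ κ VSBM.gammaV f f (VSBM.proj u)
        = σ ^ 2 / 2 * (VSBM.hs (VSBM.hessV f u) (VSBM.hessV f u)
            + ((n : ℝ) - 2) * ‖VSBM.gradV f u‖ ^ 2)
          - κ * ⟪VSBM.gradV f u, VSBM.gradH f u⟫_ℝ
    ∧ VSBM.gammaTwo σ κ VSBM.gammaVH f f (VSBM.proj u)
        = σ ^ 2 / 2 * (VSBM.hs (VSBM.hessV f u) (VSBM.hessVH f u)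
            + ((n : ℝ) - 1) / 2 * ⟪VSBM.gradV f u, VSBM.gradH f u⟫_ℝ
            - ⟪VSBM.hessVXi f u, VSBM.gradV f u⟫_ℝ)
          + κ / 2 * (⟪VSBM.riemann u.pt (VSBM.gradV f u) (u.e 0) (u.e 0), VSBM.gradV f u⟫_ℝ
            - ‖VSBM.gradH f u‖ ^ 2)
    ∧ VSBM.gammaTwo σ κ VSBM.gammaH f f (VSBM.proj u)
        = σ ^ 2 / 2 * (VSBM.hs (VSBM.hessVH f u) (VSBM.hessVH f u)
            + ‖VSBM.gradH f u‖ ^ 2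
            - 2 * ⟪VSBM.hessVXi f u, VSBM.gradH f u⟫_ℝ)
          + κ * ⟪VSBM.riemann u.pt (VSBM.gradV f u) (u.e 0) (u.e 0), VSBM.gradH f u⟫_ℝ
    ∧ VSBM.gammaTwo σ κ VSBM.gammaXi f f (VSBM.proj u)
        = σ ^ 2 / 2 * (‖VSBM.hessVXi f u‖ ^ 2
            + ((n : ℝ) - 1) * ‖VSBM.gradXi f u‖ ^ 2
            + 2 * (VSBM.hessVH f u).trace * VSBM.xi f (VSBM.proj u)) := by
  subst hn
  -- The single chart used is the one around `u.pt`, which is also the chart in which `riemann` is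
  -- defined at that point.
  obtain ⟨D, hD, hDW, huN, φ, hφ, hdep⟩ := hf.exists_represents u
  have hself := mem_extChartAt_source (I := 𝓡 (m + 1)) u.pt
  set z := VSBM.chartFrame u.pt u
  set ε : VSBM.smoothOn (VSBM.frameSet m D) →ₐ[ℝ] ℝ := VSBM.evalAt z
  set X : Fin (m + 1) → Derivation ℝ (VSBM.smoothOn (VSBM.frameSet m D))
    (VSBM.smoothOn (VSBM.frameSet m D)) := VSBM.chartVert hD
  set Y : Fin (m + 1) → Derivation ℝ (VSBM.smoothOn (VSBM.frameSet m D))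
    (VSBM.smoothOn (VSBM.frameSet m D)) := VSBM.chartHor hD hDW
  have hrel : VSBM.FrameRelations (fun i : Fin m => X i.succ) Y φ
      (fun i => Y 0 (Y i.succ φ) - Y i.succ (Y 0 φ)) :=
    VSBM.frameRelations (VSBM.isOpen_chartDom u.pt) (VSBM.contDiffOn_chris u.pt)
      (VSBM.isOpen_frameSet hD) (fun _ hz => hDW _ hz) hdep
  have hX := VSBM.isRotFamily_vert (c := u.pt) hD
  have hY := VSBM.isRotFamily_hor (c := u.pt) hD hDW
  have hL := VSBM.represents_gen hD hDW σ κ hφ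
  have hV : ∀ i, VSBM.V i (f ∘ VSBM.proj) u = ε (X i.succ φ) := fun i =>
    hX.represents i.succ hφ u hself huN
  have hH : ∀ i, VSBM.H i (f ∘ VSBM.proj) u = ε (Y i φ) := fun i =>
    hY.represents i hφ u hself huN
  have hVV : ∀ i j, VSBM.V i (VSBM.V j (f ∘ VSBM.proj)) u = ε (X i.succ (X j.succ φ)) :=
    fun i j => hX.represents i.succ (hX.represents j.succ hφ) u hself huN
  have hVH : ∀ i j, VSBM.V i (VSBM.H j (f ∘ VSBM.proj)) u = ε (X i.succ (Y j φ)) :=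
    fun i j => hX.represents i.succ (hY.represents j hφ) u hself huN
  have hρ : ∀ i : Fin m, ε (Y 0 (Y i.succ φ) - Y i.succ (Y 0 φ))
      = ∑ j, VSBM.jacobiMat u i j * ε (X j.succ φ) :=
    VSBM.commutator_hor_apply hD hDW hdep huN
  have hcast : ((m + 1 : ℕ) : ℝ) = (m : ℝ) + 1 := by push_cast; rfl
  -- Reduces each `Γ₂` at the given point to evaluation of an algebraic expression, once the three
  -- functions involved have representatives in the chart.
  have hΓ : ∀ {Γ : (VSBM.UnitTangent m M → ℝ) → (VSBM.UnitTangent m M → ℝ) →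
      VSBM.UnitTangent m M → ℝ} {χ χ₁ χ₂ : VSBM.smoothOn (VSBM.frameSet m D)},
      VSBM.Represents u.pt (VSBM.frameSet m D) (Γ f f ∘ VSBM.proj) χ.1 →
      VSBM.Represents u.pt (VSBM.frameSet m D) (Γ (VSBM.gen σ κ f) f ∘ VSBM.proj) χ₁.1 →
      VSBM.Represents u.pt (VSBM.frameSet m D) (Γ f (VSBM.gen σ κ f) ∘ VSBM.proj) χ₂.1 →
      VSBM.gammaTwo σ κ Γ f f (VSBM.proj u)
        = 1 / 2 * ε (VSBM.chartGen hD hDW σ κ χ - (χ₁ + χ₂)) := by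
    intro Γ χ χ₁ χ₂ h h₁ h₂
    rw [VSBM.gammaTwo,
      show VSBM.gen σ κ (Γ f f) (VSBM.proj u) = ε (VSBM.chartGen hD hDW σ κ χ) from
        VSBM.represents_gen hD hDW σ κ h u hself huN,
      show Γ (VSBM.gen σ κ f) f (VSBM.proj u) = ε χ₁ from h₁ u hself huN,
      show Γ f (VSBM.gen σ κ f) (VSBM.proj u) = ε χ₂ from h₂ u hself huN, sub_sub, ← map_add,
      ← map_sub]
  refine ⟨?_, ?_, ?_, ?_⟩
  · rw [hΓ (VSBM.represents_gammaV hD hφ hφ) (VSBM.represents_gammaV hD hL hφ)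
      (VSBM.represents_gammaV hD hφ hL)]
    refine (congrArg (fun r => 1 / 2 * r) (hrel.eval_vert (s := σ ^ 2 / 2) (κ := κ) ε)).trans ?_
    rw [← real_inner_self_eq_norm_sq, VSBM.gradV, VSBM.gradH, VSBM.inner_frame_sum,
      VSBM.inner_frame_sum]
    simp only [VSBM.hs, VSBM.hessV, Matrix.of_apply, hV, hH, hVV, hcast]
    ring
  · rw [hΓ (VSBM.represents_gammaVH hD hDW hφ hφ) (VSBM.represents_gammaVH hD hDW hL hφ)
      (VSBM.represents_gammaVH hD hDW hφ hL)]
    -- For equal arguments the two halves of the symmetrised `Γ^{v,h̃}` coincide; `h3` similarly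
    -- regroups the terms in which one argument is `L f`.
    have h2 : ∀ x : VSBM.smoothOn (VSBM.frameSet m D), (1 / 2 : ℝ) • (x + x) = x :=
      fun x => by module
    have h3 : ∀ x y : VSBM.smoothOn (VSBM.frameSet m D),
        (1 / 2 : ℝ) • (x + y) + (1 / 2 : ℝ) • (y + x) = x + y := fun x y => by module
    rw [h2, h3]
    refine (congrArg (fun r => 1 / 2 * r)
      (hrel.eval_vert_hor (s := σ ^ 2 / 2) (κ := κ) ε)).trans ?_
    rw [← real_inner_self_eq_norm_sq, VSBM.gradV, VSBM.gradH, VSBM.hessVXi,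
      VSBM.inner_frame_sum, VSBM.inner_frame_sum, VSBM.inner_frame_sum, VSBM.inner_riemann_sum]
    simp only [VSBM.hs, VSBM.hessV, VSBM.hessVH, Matrix.of_apply, hV, hH, hVV, hVH, hρ, hcast]
    have h4 : ∑ i, (∑ j, VSBM.jacobiMat u i j * ε (X j.succ φ)) * ε (X i.succ φ)
        = ∑ i, ∑ j, ε (X i.succ φ) * ε (X j.succ φ) * VSBM.jacobiMat u i j := by
      simp only [Finset.sum_mul]
      exact Finset.sum_congr rfl fun i _ => Finset.sum_congr rfl fun j _ => by ring
    rw [h4]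
    ring
  · rw [hΓ (VSBM.represents_gammaH hD hDW hφ hφ) (VSBM.represents_gammaH hD hDW hL hφ)
      (VSBM.represents_gammaH hD hDW hφ hL)]
    refine (congrArg (fun r => 1 / 2 * r) (hrel.eval_hor (s := σ ^ 2 / 2) (κ := κ) ε)).trans ?_
    rw [← real_inner_self_eq_norm_sq, VSBM.gradV, VSBM.gradH, VSBM.hessVXi,
      VSBM.inner_frame_sum, VSBM.inner_frame_sum, VSBM.inner_riemann_sum]
    simp only [VSBM.hs, VSBM.hessVH, Matrix.of_apply, hV, hH, hVH, hρ]
    have h4 : ∑ i, (∑ j, VSBM.jacobiMat u i j * ε (X j.succ φ)) * ε (Y i.succ φ)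
        = ∑ i, ∑ j, ε (X i.succ φ) * ε (Y j.succ φ) * VSBM.jacobiMat u i j := by
      simp only [Finset.sum_mul]
      rw [Finset.sum_comm]
      exact Finset.sum_congr rfl fun i _ => Finset.sum_congr rfl fun j _ => by
        -- After exchanging the summation indices, the symmetry of the Jacobi matrix restores the
        -- order in which the curvature pairs `∇^v f` with `∇^{h̃} f`.
        rw [VSBM.jacobiMat_symm u j i]
        ring
    rw [h4]
    ring
  · rw [hΓ (VSBM.represents_gammaXi hD hDW hφ hφ) (VSBM.represents_gammaXi hD hDW hL hφ)
      (VSBM.represents_gammaXi hD hDW hφ hL)]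
    refine (congrArg (fun r => 1 / 2 * r) (hrel.eval_geod (s := σ ^ 2 / 2) (κ := κ) ε)).trans ?_
    have h2 : VSBM.xi f (VSBM.proj u) = ε (Y 0 φ) := VSBM.represents_xi hD hDW hφ u hself huN
    have h3 : ‖VSBM.gradXi f u‖ ^ 2 = ε (Y 0 φ) * ε (Y 0 φ) := by
      rw [VSBM.gradXi, ← real_inner_self_eq_norm_sq, real_inner_smul_left, real_inner_smul_right,
        orthonormal_iff_ite.1 u.e.orthonormal, if_pos rfl, mul_one, hH]
    rw [h2, h3, ← real_inner_self_eq_norm_sq, VSBM.hessVXi, VSBM.inner_frame_sum]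
    simp only [VSBM.hessVH, Matrix.trace, Matrix.diag_apply, Matrix.of_apply, hVH, hcast]
    ring
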